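/- Let $k$ be an algebraically closed field of characteristic $2$ and let $G=C_2\times C_2=\langle g_1,g_2\rangle$ be the Klein four group. Given a representation $X$ of the Kronecker quiver, that is, a pair of linear maps $X_{\alpha_1},X_{\alpha_2}\colon X_1\to X_2$ between $k$-vector spaces, let $TX$ be the representation of $G$ on $X_1\oplus X_2$ in which $g_i$ acts as $\mathrm{id}+\begin{pmatrix}0&0\\ X_{\alpha_i}&0\end{pmatrix}$ for $i=1,2$. Consider the following Kronecker representations, written $(X_{\alpha_1},X_{\alpha_2})$. - $P_r\colon k^r\rightrightarrows k^{r+1}$ given by $\left(\begin{pmatrix}\mathrm{id}\\0\end{pmatrix},\begin{pmatrix}0\\\mathrm{id}\end{pmatrix}\right)$, where $\mathrm{id}=\mathrm{id}_{k^r}$. - $I_r\colon k^{r+1}\rightrightarrows k^{r}$ given by $\left(\begin{pmatrix}\mathrm{id}&0\end{pmatrix},\begin{pmatrix}0&\mathrm{id}\end{pmatrix}\right)$, where $\mathrm{id}=\mathrm{id}_{k^r}$. - For $p\ge 1$ and $\lambda\in\mathbb P^1(k)$, $R_{p,\lambda}\colon k^p\rightrightarrows k^p$ given by $(J(p,\lambda_0),\mathrm{id})$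 if $\lambda=(\lambda_0:1)$ and by $(\mathrm{id},J(p,0))$ if $\lambda=(1:0)$, where $J(p,\mu)$ is the Jordan block of size $p$ with eigenvalue $\mu$, sending $e_i$ to $\mu e_i+e_{i-1}$ (with $e_0=0$). Then the representations $$k[G],\qquad TP_r\ (r\ge 1),\qquad TI_r\ (r\ge 0),\qquad TR_{p,\lambda}\ (p\ge 1,\ \lambda\in\mathbb P^1(k))$$ form, up to isomorphism, a complete list of the finite-dimensional indecomposable $k$-linear representations of $G$: each of them is finite-dimensional and indecomposable, every finite-dimensional indecomposable representation of $G$ over $k$ is isomorphic to one of them, and no two of them with different labels are isomorphic. Here $k[G]$ is the regular representation, and a representation $X$ is indecomposable if $X\ne 0$ and $X=X'\oplus X''$ with subrepresentations $X',X''$ implies $X'=0$ or $X''=0$. -/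

import Mathlib

universe u v w

/-- The Klein four group `C₂ × C₂`. -/
abbrev KleinFour : Type := Multiplicative (ZMod 2) × Multiplicative (ZMod 2)

namespace KleinFour

/-- The generator of the first factor. -/
def g₁ : KleinFour := (Multiplicative.ofAdd 1, 1)

/-- The generator of the second factor. -/
def g₂ : KleinFour := (1, Multiplicative.ofAdd 1)

end KleinFour

/-- A representation is indecomposable if it is non-zero and `X = U ⊕ W` with
subrepresentations `U`, `W` forces `U = 0` or `W = 0`. -/
def Representation.IsIndecomposable {k : Type u} {G : Type v} {V : Type w} [Field k] [Group G]
    [AddCommGroup V] [Module k V] (ρ : Representation k G V) : Prop :=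
  Nontrivial V ∧ ∀ U W : Subrepresentation ρ, IsCompl U W → U = ⊥ ∨ W = ⊥

section LoopRepresentation

variable {k : Type u} {M : Type v} [Field k] [AddCommGroup M] [Module k M]

theorem one_add_sq_eq_one_of_sq_eq_zero [CharP k 2] {A : Module.End k M} (hA : A ^ 2 = 0) :
    (1 + A) ^ 2 = 1 := by
  have h2 : (2 : k) = 0 := by exact_mod_cast CharP.cast_eq_zero k 2
  have h : A + A = 0 := by rw [← two_smul k A, h2, zero_smul]
  have : (1 + A) ^ 2 = 1 + (A + A) + A ^ 2 := by noncomm_ring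
  rw [this, h, hA, add_zero, add_zero]

theorem pow_val_add_of_sq_eq_one {R : Type v} [Monoid R] {a : R} (ha : a ^ 2 = 1) (x y : ZMod 2) :
    a ^ (x + y).val = a ^ x.val * a ^ y.val := by
  rw [ZMod.val_add, ← pow_add, ← pow_mod_orderOf a ((x.val + y.val) % 2),
    Nat.mod_mod_of_dvd _ (orderOf_dvd_of_pow_eq_one ha), pow_mod_orderOf]

/-- The representation of the Klein four group over a field of characteristic two that is given
by two commuting endomorphisms `A`, `B` of square zero: the group element `g₁` acts as `1 + A`
and the group element `g₂` acts as `1 + B`. -/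
def loopRepresentation [CharP k 2] (A B : Module.End k M) (hAB : Commute A B)
    (hA : A ^ 2 = 0) (hB : B ^ 2 = 0) : Representation k KleinFour M where
  toFun g := (1 + A) ^ (g.1.toAdd).val * (1 + B) ^ (g.2.toAdd).val
  map_one' := by simp
  map_mul' g h := by
    have hc : Commute (1 + A) (1 + B) :=
      (Commute.one_left _).add_left ((Commute.one_right _).add_right hAB)
    simp only [Prod.fst_mul, Prod.snd_mul, toAdd_mul,
      pow_val_add_of_sq_eq_one (one_add_sq_eq_one_of_sq_eq_zero hA),
      pow_val_add_of_sq_eq_one (one_add_sq_eq_one_of_sq_eq_zero hB)]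
    exact (hc.pow_pow _ _).symm.mul_mul_mul_comm _ _ |>.symm

theorem loopRepresentation_g₁ [CharP k 2] (A B : Module.End k M) (hAB : Commute A B)
    (hA : A ^ 2 = 0) (hB : B ^ 2 = 0) :
    loopRepresentation A B hAB hA hB KleinFour.g₁ = 1 + A := by
  simp [loopRepresentation, KleinFour.g₁, ZMod.val_one]

theorem loopRepresentation_g₂ [CharP k 2] (A B : Module.End k M) (hAB : Commute A B)
    (hA : A ^ 2 = 0) (hB : B ^ 2 = 0) :
    loopRepresentation A B hAB hA hB KleinFour.g₂ = 1 + B := by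
  simp [loopRepresentation, KleinFour.g₂, ZMod.val_one]

end LoopRepresentation

/-- A representation of the Kronecker quiver with two vertices `1`, `2` and two arrows
`α₁, α₂ : 1 → 2`, on the vector spaces `V` (at `1`) and `W` (at `2`). -/
structure KroneckerRep (k : Type u) (V : Type v) (W : Type w) [Field k]
    [AddCommGroup V] [Module k V] [AddCommGroup W] [Module k W] where
  α₁ : V →ₗ[k] W
  α₂ : V →ₗ[k] W

section BlockMap

variable {k : Type u} {V : Type v} {W : Type w} [Field k]
  [AddCommGroup V] [Module k V] [AddCommGroup W] [Module k W]

/-- The endomorphism of `V ⊕ W` with block matrix `(0 0; a 0)`, that is `(v, w) ↦ (0, a v)`. -/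
def lowerBlock (a : V →ₗ[k] W) : Module.End k (V × W) :=
  LinearMap.inr k V W ∘ₗ a ∘ₗ LinearMap.fst k V W

theorem lowerBlock_mul (a b : V →ₗ[k] W) : lowerBlock a * lowerBlock b = 0 := by
  ext <;> simp [lowerBlock]

/-- The object map of the functor `T` from Kronecker representations to representations of the
Klein four group in characteristic two: `TX = X₁ ⊕ X₂`, where `gᵢ - 1` acts as
`(0 0; X_{αᵢ} 0)`. -/
def KroneckerRep.T [CharP k 2] (X : KroneckerRep k V W) : Representation k KleinFour (V × W) :=
  loopRepresentation (lowerBlock X.α₁) (lowerBlock X.α₂)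
    (by rw [commute_iff_eq, lowerBlock_mul, lowerBlock_mul])
    (by rw [sq, lowerBlock_mul]) (by rw [sq, lowerBlock_mul])

end BlockMap

/-- The Jordan block of size `p` with eigenvalue `μ`, sending `e_i` to `μ e_i + e_{i-1}`. -/
def jordanBlock {k : Type u} [Field k] (p : ℕ) (μ : k) : Matrix (Fin p) (Fin p) k :=
  Matrix.of fun i j => if i = j then μ else if (j : ℕ) = i + 1 then 1 else 0

namespace KroneckerRep

variable (k : Type u) [Field k]

/-- The preprojective representation `P_r : k^r ⇉ k^{r+1}` with the block matrices
`(id; 0)` and `(0; id)`. -/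
noncomputable def P (r : ℕ) : KroneckerRep k (Fin r → k) (Fin (r + 1) → k) where
  α₁ := Matrix.toLin' (Matrix.of fun i j => if i = j.castSucc then 1 else 0)
  α₂ := Matrix.toLin' (Matrix.of fun i j => if i = j.succ then 1 else 0)

/-- The preinjective representation `I_r : k^{r+1} ⇉ k^r` with the block matrices
`(id 0)` and `(0 id)`. -/
noncomputable def I (r : ℕ) : KroneckerRep k (Fin (r + 1) → k) (Fin r → k) where
  α₁ := Matrix.toLin' (Matrix.of fun i j => if j = i.castSucc then 1 else 0)
  α₂ := Matrix.toLin' (Matrix.of fun i j => if j = i.succ then 1 else 0)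

variable {k}

open Classical in
/-- The regular representation `R_{p,λ} : k^p ⇉ k^p` for a point `λ` of the projective line:
it is `(J(p, λ₀), id)` for `λ = (λ₀ : 1)`, and `(id, J(p, 0))` for `λ = (1 : 0)`.
For `λ = (1 : λ₁)` with `λ₁ ≠ 0` one could equally well take `(id, J(p, λ₁))`, which is
isomorphic to `(J(p, λ₁⁻¹), id)`. -/
noncomputable def R (p : ℕ) (l : Projectivization k (Fin 2 → k)) :
    KroneckerRep k (Fin p → k) (Fin p → k) :=
  if l.rep 1 = 0 then
    { α₁ := LinearMap.id
      α₂ := Matrix.toLin' (jordanBlock p 0) }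
  else
    { α₁ := Matrix.toLin' (jordanBlock p (l.rep 0 / l.rep 1))
      α₂ := LinearMap.id }

theorem R_affine (p : ℕ) (μ : k) (h : ![μ, 1] ≠ 0) :
    R p (Projectivization.mk k ![μ, 1] h) =
      { α₁ := Matrix.toLin' (jordanBlock p μ), α₂ := LinearMap.id } := by
  obtain ⟨a, ha⟩ := Projectivization.exists_smul_eq_mk_rep k ![μ, 1] h
  have h0 : (Projectivization.mk k ![μ, 1] h).rep 0 = a * μ := by
    rw [← ha]; simp [Units.smul_def]
  have h1 : (Projectivization.mk k ![μ, 1] h).rep 1 = a := by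
    rw [← ha]; simp [Units.smul_def]
  rw [R, h0, h1, if_neg a.ne_zero, mul_div_cancel_left₀ _ a.ne_zero]

theorem R_infinity (p : ℕ) (h : ![(1 : k), 0] ≠ 0) :
    R p (Projectivization.mk k ![1, 0] h) =
      { α₁ := LinearMap.id, α₂ := Matrix.toLin' (jordanBlock p 0) } := by
  obtain ⟨a, ha⟩ := Projectivization.exists_smul_eq_mk_rep k ![(1 : k), 0] h
  have h1 : (Projectivization.mk k ![(1 : k), 0] h).rep 1 = 0 := by
    rw [← ha]; simp
  rw [R, if_pos h1]

end KroneckerRep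

/-- The index set of the list: one index for `k[G]`, one for each `TP_r` with `r ≥ 1`, one for
each `TI_r` with `r ≥ 0`, and one for each `TR_{p,λ}` with `p ≥ 1` and `λ ∈ ℙ¹(k)`. -/
inductive KleinIndex (k : Type u) [Field k] : Type u
  | regular : KleinIndex k
  | preprojective (r : ℕ) (hr : 1 ≤ r) : KleinIndex k
  | preinjective (r : ℕ) : KleinIndex k
  | tube (p : ℕ) (hp : 1 ≤ p) (l : Projectivization k (Fin 2 → k)) : KleinIndex k

/-- The representations of the Klein four group in the list. -/
noncomputable def kleinRep {k : Type u} [Field k] [CharP k 2] : KleinIndex k → Rep.{u} k KleinFour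
  | .regular => Rep.leftRegular k KleinFour
  | .preprojective r _ => Rep.of (KroneckerRep.P k r).T
  | .preinjective r => Rep.of (KroneckerRep.I k r).T
  | .tube p _ l => Rep.of (KroneckerRep.R p l).T

/-! Put `A = g₁ - 1` and `B = g₂ - 1`; in characteristic 2 these commute and square to zero. If `A B
v ≠ 0` for some `v`, then `v` generates a copy of `k[G]`, which is injective as a module over itself
and so splits off. Otherwise `A` and `B` kill `N = im A + im B`, and a choice of complement `M` of
`N` turns the representation into `TX` for the pencil `(A, B) : M ⇉ N`. What remains is Kronecker's
classification of pencils.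

Completeness uses one principle: an indecomposable is isomorphic to each of its nonzero retracts
(`IsIndecomposable.nonempty_equiv_of_retract`), so it is enough to find one listed representation as
a retract. A chain of minimal length in the pencil yields `I_r`, and one in the transposed pencil
yields `P_r`, because minimality provides dual functionals (`IsPencilChain.exists_dual`). If neither
pencil has a chain, then both spaces have the same dimension and some member is invertible: were all
members singular, the coefficients of a polynomial kernel vector would form a chain. The pencil then
amounts to a single endomorphism, from which a Jordan block splits off.

Indecomposability of `TX` reduces to idempotent endomorphisms of `X` (`isIndecomposable_T`). These
act by a scalar on a one-dimensional kernel, and the scalar propagates along a chain that spans.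
Isomorphism types are separated by dimension, by the vanishing of `A B`, by the dimension of `im A +
im B` (`P_r` against `I_r`), and by the singular member of the pencil (the parameter `λ`). -/

/-! ### Retracts of indecomposable representations -/

namespace Subrepresentation

variable {k G V : Type*} [Field k] [Group G] [AddCommGroup V] [Module k V]
  {ρ : Representation k G V}

theorem toSubmodule_eq_bot {U : Subrepresentation ρ} : U.toSubmodule = ⊥ ↔ U = ⊥ :=
  ⟨fun h => Subrepresentation.ext h, fun h => by rw [h]; rfl⟩

theorem isCompl_toSubmodule {U W : Subrepresentation ρ} :
    IsCompl U.toSubmodule W.toSubmodule ↔ IsCompl U W := by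
  simp only [isCompl_iff, disjoint_iff, codisjoint_iff, Subrepresentation.ext_iff]
  rfl

end Subrepresentation

namespace Representation

variable {k G V V' : Type*} [Field k] [Group G] [AddCommGroup V] [Module k V]
  [AddCommGroup V'] [Module k V'] {ρ : Representation k G V} {σ : Representation k G V'}

/-- An indecomposable representation is isomorphic to each of its nonzero retracts. -/
theorem IsIndecomposable.nonempty_equiv_of_retract (hρ : ρ.IsIndecomposable) [Nontrivial V']
    (s : σ.IntertwiningMap ρ) (r : ρ.IntertwiningMap σ)
    (h : Function.Bijective fun x => r (s x)) : Nonempty (ρ.Equiv σ) := by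
  have hs : Function.Injective s := fun x y hxy => h.1 (congrArg r hxy)
  -- Up to the automorphism `r ∘ s`, the map `s ∘ r` is a projection onto the image of `s`. As that
  -- image is nonzero, the kernel of `r` must vanish.
  have hc : IsCompl s.range r.ker := by
    rw [← Subrepresentation.isCompl_toSubmodule, isCompl_iff, Submodule.disjoint_def,
      codisjoint_iff, Submodule.eq_top_iff']
    constructor
    · rintro _ ⟨x, rfl⟩ hx
      have h0 : r (s x) = r (s 0) := by
        have : r (s x) = 0 := hx
        simp [this]
      have : x = 0 := h.1 h0
      subst this
      exact map_zero s
    · intro v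
      obtain ⟨x, hx⟩ := h.2 (r v)
      refine Submodule.mem_sup.2 ⟨s x, ⟨x, rfl⟩, v - s x, ?_, by simp⟩
      change r (v - s x) = 0
      rw [map_sub, sub_eq_zero]
      exact hx.symm
  rcases hρ.2 _ _ hc with h0 | h0
  · obtain ⟨x, hx⟩ := exists_ne (0 : V')
    have hm : s x ∈ s.range.toSubmodule := ⟨x, rfl⟩
    rw [Subrepresentation.toSubmodule_eq_bot.2 h0, Submodule.mem_bot] at hm
    exact absurd (hs (hm.trans (map_zero s).symm)) hx
  · refine ⟨r.ofBijective ⟨?_, fun y => (h.2 y).imp' s fun _ hx => hx⟩⟩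
    exact LinearMap.ker_eq_bot.1 (Subrepresentation.toSubmodule_eq_bot.2 h0)

theorem IsIndecomposable.of_equiv (hρ : ρ.IsIndecomposable) (e : ρ.Equiv σ) :
    σ.IsIndecomposable := by
  have he : ∀ g v, e (ρ g v) = σ g (e v) := 
    IntertwiningMap.isIntertwining ρ σ e.toIntertwiningMap
  let c (U : Subrepresentation σ) : Subrepresentation ρ :=
    ⟨U.toSubmodule.comap (e.toLinearEquiv : V →ₗ[k] V'), fun g v hv => by
      change e (ρ g v) ∈ U.toSubmodule
      rw [he]
      exact U.apply_mem_toSubmodule g hv⟩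
  have hbot : ∀ U, c U = ⊥ → U = ⊥ := fun U hU => by
    rw [← Subrepresentation.toSubmodule_eq_bot] at hU ⊢
    exact Submodule.comap_injective_of_surjective e.toLinearEquiv.surjective
      (hU.trans (LinearMap.ker_eq_bot.2 e.toLinearEquiv.injective).symm)
  refine ⟨have := hρ.1; e.toLinearEquiv.injective.nontrivial, fun U W h => ?_⟩
  refine (hρ.2 (c U) (c W) ?_).imp (hbot U) (hbot W)
  rw [← Subrepresentation.isCompl_toSubmodule] at h ⊢
  exact h.map (Submodule.orderIsoMapComap e.toLinearEquiv).symm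

end Representation

namespace KleinFour

theorem cases_generators (g : KleinFour) : g = 1 ∨ g = g₁ ∨ g = g₂ ∨ g = g₁ * g₂ := by
  revert g; decide

variable {k V V' : Type*} [Field k] [AddCommGroup V] [Module k V]
  [AddCommGroup V'] [Module k V'] {ρ : Representation k KleinFour V}
  {σ : Representation k KleinFour V'}

/-- A linear map that commutes with the two generators is an intertwining map. -/
def intertwiningMap (f : V →ₗ[k] V') (h₁ : ∀ v, f (ρ g₁ v) = σ g₁ (f v))
    (h₂ : ∀ v, f (ρ g₂ v) = σ g₂ (f v)) : ρ.IntertwiningMap σ :=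
  f.intertwiningMap_of_isIntertwiningMap ρ σ fun g v => by
    rcases cases_generators g with rfl | rfl | rfl | rfl <;> simp [h₁, h₂]

/-- A subspace that is stable under the two generators is a subrepresentation. -/
def subrepresentation (U : Submodule k V) (h₁ : ∀ v ∈ U, ρ g₁ v ∈ U)
    (h₂ : ∀ v ∈ U, ρ g₂ v ∈ U) : Subrepresentation ρ where
  toSubmodule := U
  apply_mem_toSubmodule g v hv := by
    rcases cases_generators g with rfl | rfl | rfl | rfl
    · simpa using hv
    · exact h₁ v hv
    · exact h₂ v hv
    · simpa using h₁ _ (h₂ v hv)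

end KleinFour

namespace KroneckerRep

variable {k V W V' W' : Type*} [Field k] [CharP k 2] [AddCommGroup V] [Module k V]
  [AddCommGroup W] [Module k W] [AddCommGroup V'] [Module k V'] [AddCommGroup W'] [Module k W']

@[simp]
theorem T_g₁_apply (X : KroneckerRep k V W) (z : V × W) :
    X.T KleinFour.g₁ z = (z.1, z.2 + X.α₁ z.1) := by
  rw [T, loopRepresentation_g₁]
  ext <;> simp [lowerBlock]

@[simp]
theorem T_g₂_apply (X : KroneckerRep k V W) (z : V × W) :
    X.T KleinFour.g₂ z = (z.1, z.2 + X.α₂ z.1) := by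
  rw [T, loopRepresentation_g₂]
  ext <;> simp [lowerBlock]

/-- The functor `T` on a morphism `(f, g)` of Kronecker representations. -/
def mapT {X : KroneckerRep k V W} {Y : KroneckerRep k V' W'} (f : V →ₗ[k] V') (g : W →ₗ[k] W')
    (h₁ : ∀ v, g (X.α₁ v) = Y.α₁ (f v)) (h₂ : ∀ v, g (X.α₂ v) = Y.α₂ (f v)) :
    X.T.IntertwiningMap Y.T :=
  KleinFour.intertwiningMap (f.prodMap g) (by simp [h₁]) (by simp [h₂])

/-- A Kronecker representation with indecomposable image under `T` has the same image as each of
its nonzero retracts. -/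
theorem nonempty_equiv_of_retract {X : KroneckerRep k V W} {Y : KroneckerRep k V' W'}
    [Nontrivial (V' × W')] (hX : X.T.IsIndecomposable)
    (s : V' →ₗ[k] V) (s' : W' →ₗ[k] W) (r : V →ₗ[k] V') (r' : W →ₗ[k] W')
    (hs₁ : ∀ v, s' (Y.α₁ v) = X.α₁ (s v)) (hs₂ : ∀ v, s' (Y.α₂ v) = X.α₂ (s v))
    (hr₁ : ∀ v, r' (X.α₁ v) = Y.α₁ (r v)) (hr₂ : ∀ v, r' (X.α₂ v) = Y.α₂ (r v))
    (h : Function.Bijective fun x => r (s x)) (h' : Function.Bijective fun x => r' (s' x)) :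
    Nonempty (X.T.Equiv Y.T) :=
  hX.nonempty_equiv_of_retract (mapT s s' hs₁ hs₂) (mapT r r' hr₁ hr₂)
    (Function.Bijective.prodMap h h')

end KroneckerRep

/-! ### Chains in pencils of linear maps -/

section Chain

variable {k V W : Type*} [Field k] [AddCommGroup V] [Module k V] [AddCommGroup W] [Module k W]

/-- A chain of length `r` for a pencil `(a, b)`: vectors `v₀ ≠ 0, v₁, …, vᵣ` with
`b v₀ = 0`, `b vᵢ₊₁ = a vᵢ` and `a vᵣ = 0`. -/
structure IsPencilChain (a b : V →ₗ[k] W) (r : ℕ) (v : ℕ → V) : Prop where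
  ne_zero : v 0 ≠ 0
  first : b (v 0) = 0
  step : ∀ i < r, b (v (i + 1)) = a (v i)
  last : a (v r) = 0

/-- Functionals dual to a chain of positive minimal length. -/
theorem IsPencilChain.exists_dual {a b : V →ₗ[k] W} {m : ℕ} {v : ℕ → V}
    (hv : IsPencilChain a b (m + 1) v) (hmin : ∀ v', ¬ IsPencilChain a b m v') :
    ∃ g : ℕ → Module.Dual k W, (∀ i < m, ∀ x, g i (b x) = g (i + 1) (a x)) ∧
      ∀ i ≤ m, ∀ j ≤ m, g i (a (v j)) = if i = j then 1 else 0 := by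
  classical
  -- The obstruction space: its elements are the defects of the chain equation for sequences `z`
  -- that vanish at both ends. Entries beyond `m` play no role.
  let S : Submodule k (ℕ → W) :=
    { carrier := {y | ∃ z : ℕ → V, z 0 = 0 ∧ z (m + 1) = 0 ∧
        ∀ j ≤ m, y j = b (z (j + 1)) - a (z j)}
      zero_mem' := ⟨0, by simp⟩
      add_mem' := by
        rintro y y' ⟨z, h₁, h₂, h₃⟩ ⟨z', h₁', h₂', h₃'⟩
        refine ⟨z + z', by simp [h₁, h₁'], by simp [h₂, h₂'], fun j hj => ?_⟩
        simp only [Pi.add_apply, h₃ j hj, h₃' j hj, map_add]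
        abel
      smul_mem' := by
        rintro c y ⟨z, h₁, h₂, h₃⟩
        refine ⟨c • z, by simp [h₁], by simp [h₂], fun j hj => ?_⟩
        simp only [Pi.smul_apply, h₃ j hj, map_smul, smul_sub] }
  -- Otherwise `v₀, z₁, …, zₘ` would be a chain of length `m`.
  have hS : Pi.single 0 (a (v 0)) ∉ S := by
    rintro ⟨z, h₁, h₂, h₃⟩
    refine hmin (Function.update z 0 (v 0)) ⟨?_, ?_, fun i hi => ?_, ?_⟩
    · simpa using hv.ne_zero
    · simpa using hv.first
    · have := h₃ i hi.le
      rcases i with _ | i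
      · simpa [h₁] using this.symm
      · simpa using (sub_eq_zero.1 (this.symm.trans (by simp)))
    · have := h₃ m le_rfl
      rcases m with _ | m
      · simpa [h₁, h₂] using this
      · simpa [h₂] using this
  obtain ⟨G, hG, hGS⟩ := Submodule.exists_le_ker_of_notMem hS
  let g (i : ℕ) : Module.Dual k W :=
    (G (Pi.single 0 (a (v 0))))⁻¹ • G ∘ₗ LinearMap.single k (fun _ : ℕ => W) i
  -- Vanishing of `G` on the defect of the sequence concentrated at `i + 1`.
  have hg : ∀ i < m, ∀ x, g i (b x) = g (i + 1) (a x) := by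
    intro i hi x
    have hmem : Pi.single i (b x) - Pi.single (i + 1) (a x) ∈ S := by
      refine ⟨Pi.single (i + 1) x, by simp, ?_, fun j hj => ?_⟩
      · rw [Pi.single_eq_of_ne (by omega)]
      · simp only [Pi.sub_apply, Pi.single_apply, add_left_inj]
        split_ifs <;> simp
    have := hGS hmem
    rw [LinearMap.mem_ker, map_sub, sub_eq_zero] at this
    simp [g, this]
  have hzero : g 0 (a (v 0)) = 1 := by simp [g, hG]
  -- The matrix `g i (a (v j))` is thus Toeplitz. Above the diagonal it vanishes because `a vₘ₊₁ =
  -- 0`, below because `b v₀ = 0`, and the diagonal is normalised to 1.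
  have hshift : ∀ i j, i < m → j < m → g i (a (v j)) = g (i + 1) (a (v (j + 1))) := by
    intro i j hi hj
    rw [← hg i hi, hv.step j (by omega)]
  have hdiag : ∀ d i, i + d ≤ m → ∀ j, j + d ≤ m →
      g i (a (v j)) = g (i + d) (a (v (j + d))) := by
    intro d
    induction d with
    | zero => intros; rfl
    | succ d ih =>
      intro i hi j hj
      rw [ih i (by omega) j (by omega), hshift _ _ (by omega) (by omega)]
      rfl
  refine ⟨g, hg, fun i hi j hj => ?_⟩
  rcases lt_trichotomy i j with h | rfl | h
  · rw [if_neg h.ne, hdiag (m - j) i (by omega) j (by omega), Nat.add_sub_cancel' hj,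
      ← hv.step m (by omega), hg _ (by omega), hv.last, map_zero]
  · rw [if_pos rfl, ← hzero]
    simpa using (hdiag i 0 (by omega) 0 (by omega)).symm
  · rw [if_neg h.ne']
    have := hdiag j (i - j) (by omega) 0 (by omega)
    rw [Nat.sub_add_cancel h.le, Nat.zero_add] at this
    obtain ⟨d, hd⟩ : ∃ d, i - j = d + 1 := ⟨i - j - 1, by omega⟩
    rw [← this, hd, ← hg d (by omega), hv.first, map_zero]

open Polynomial in
/-- A square pencil all of whose members are singular has a chain. -/
theorem exists_isPencilChain_of_det_eq_zero [Infinite k] {n : ℕ} (A B : Matrix (Fin n) (Fin n) k)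
    (h : ∀ t : k, (B - t • A).det = 0) :
    ∃ r v, IsPencilChain (Matrix.toLin' A) (Matrix.toLin' B) r v := by
  classical
  -- Over an infinite field the determinant vanishes as a polynomial, so `B - X A` kills a nonzero
  -- polynomial vector. Comparing coefficients gives the chain equations.
  let M : Matrix (Fin n) (Fin n) k[X] := B.map C - (X : k[X]) • A.map C
  have hM : M.det = 0 := by
    refine Polynomial.funext fun t => ?_
    rw [eval_zero, ← h t, ← coe_evalRingHom, RingHom.map_det]
    congr 1
    ext i j
    simpa [M] using mul_comm _ _
  obtain ⟨p, hp, hMp⟩ := Matrix.exists_mulVec_eq_zero_iff.2 hM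
  let c (i : ℕ) : Fin n → k := fun j => (p j).coeff i
  have hc0 : Matrix.toLin' B (c 0) = 0 := by
    ext i
    have := congrArg (fun q => q.coeff 0) (congrFun hMp i)
    simpa [M, Matrix.mulVec, dotProduct, sub_mul, finsetSum_coeff, mul_assoc] using this
  have hcs : ∀ i, Matrix.toLin' B (c (i + 1)) = Matrix.toLin' A (c i) := by
    intro d
    ext i
    have := congrArg (fun q => q.coeff (d + 1)) (congrFun hMp i)
    simpa [M, Matrix.mulVec, dotProduct, sub_mul, finsetSum_coeff, mul_assoc, sub_eq_zero]
      using this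
  have hex : ∃ i, c i ≠ 0 := by
    by_contra! hcon
    exact hp (funext fun j => Polynomial.ext fun i => congrFun (hcon i) j)
  obtain ⟨N, hN⟩ : ∃ N, ∀ i, N < i → c i = 0 :=
    ⟨Finset.univ.sup fun j => (p j).natDegree, fun i hi => funext fun j =>
      coeff_eq_zero_of_natDegree_lt
        ((Finset.le_sup (f := fun j => (p j).natDegree) (Finset.mem_univ j)).trans_lt hi)⟩
  -- The chain starts at the lowest nonzero coefficient. The length `N` need not be minimal: the
  -- tail may consist of zeros.
  refine ⟨N, fun i => c (Nat.find hex + i), by simpa using Nat.find_spec hex, ?_,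
    fun i _ => hcs _, ?_⟩
  · rw [add_zero]
    rcases hd : Nat.find hex with _ | d
    · exact hc0
    · rw [hcs, not_not.1 (Nat.find_min hex (m := d) (by omega)), map_zero]
  · rw [← hcs, hN _ (by omega), map_zero]

/-- A pencil without chains and with at most as many rows as columns has an injective member. -/
theorem exists_injective_of_no_pencilChain [Infinite k] [FiniteDimensional k V]
    [FiniteDimensional k W] (a b : V →ₗ[k] W)
    (hd : Module.finrank k W ≤ Module.finrank k V) (h : ∀ r v, ¬ IsPencilChain a b r v) :
    ∃ t : k, Function.Injective (b - t • a) := by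
  classical
  by_contra! hcon
  let e : V ≃ₗ[k] (Fin (Module.finrank k V) → k) := (Module.finBasis k V).equivFun
  -- Padding the target with zero rows makes the pencil square and changes neither kernels nor
  -- chains.
  obtain ⟨j, hj⟩ : ∃ j : W →ₗ[k] (Fin (Module.finrank k V) → k), Function.Injective j := by
    refine ⟨Function.ExtendByZero.linearMap k (Fin.castLE hd) ∘ₗ
      (Module.finBasis k W).equivFun.toLinearMap, ?_⟩
    exact (Function.extend_injective (Fin.castLE_injective hd) 0).comp
      (Module.finBasis k W).equivFun.injective
  let a' := j ∘ₗ a ∘ₗ e.symm.toLinearMap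
  let b' := j ∘ₗ b ∘ₗ e.symm.toLinearMap
  obtain ⟨r, v, hv⟩ := exists_isPencilChain_of_det_eq_zero (LinearMap.toMatrix' a')
    (LinearMap.toMatrix' b') fun t => by
      rw [← map_smul, ← map_sub, LinearMap.det_toMatrix']
      by_contra hdet
      have hb := (LinearMap.equivOfDetNeZero _ hdet).injective
      refine hcon t fun x y hxy => ?_
      have : (b' - t • a') (e x) = (b' - t • a') (e y) := by
        simpa [a', b'] using congrArg j hxy
      exact e.injective (hb this)
  rw [Matrix.toLin'_toMatrix', Matrix.toLin'_toMatrix'] at hv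
  refine h r (fun i => e.symm (v i)) ⟨by simpa using hv.ne_zero, hj ?_, fun i hi => hj ?_, hj ?_⟩
  · rw [map_zero]; exact hv.first
  · exact hv.step i hi
  · rw [map_zero]; exact hv.last

end Chain

/-! ### Splitting off preinjective and preprojective pencils -/

theorem Fintype.pi_linearCombination_of_dual {k V ι : Type*} [Field k] [AddCommGroup V]
    [Module k V] [Fintype ι] [DecidableEq ι] (v : ι → V) (f : ι → Module.Dual k V)
    (h : ∀ i j, f i (v j) = if i = j then 1 else 0) (x : ι → k) :
    LinearMap.pi f (Fintype.linearCombination k v x) = x := by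
  ext i
  simp [Fintype.linearCombination_apply, h]

namespace KroneckerRep

section Apply

variable {k : Type*} [Field k] (r : ℕ)

@[simp]
theorem I_α₁_apply (x : Fin (r + 1) → k) (i : Fin r) : (I k r).α₁ x i = x i.castSucc := by
  simp [I, Matrix.mulVec, dotProduct]

@[simp]
theorem I_α₂_apply (x : Fin (r + 1) → k) (i : Fin r) : (I k r).α₂ x i = x i.succ := by
  simp [I, Matrix.mulVec, dotProduct]

@[simp]
theorem P_α₁_castSucc (x : Fin r → k) (i : Fin r) : (P k r).α₁ x i.castSucc = x i := by
  simp [P, Matrix.mulVec, dotProduct]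

@[simp]
theorem P_α₁_last (x : Fin r → k) : (P k r).α₁ x (Fin.last r) = 0 := by
  simp [P, Matrix.mulVec, dotProduct, (Fin.castSucc_lt_last _).ne']

@[simp]
theorem P_α₂_succ (x : Fin r → k) (i : Fin r) : (P k r).α₂ x i.succ = x i := by
  simp [P, Matrix.mulVec, dotProduct]

@[simp]
theorem P_α₂_zero (x : Fin r → k) : (P k r).α₂ x 0 = 0 := by
  simp [P, Matrix.mulVec, dotProduct, (Fin.succ_ne_zero _).symm]

end Apply

variable {k : Type u} {V : Type v} {W : Type w} [Field k] [CharP k 2] [AddCommGroup V]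
  [Module k V] [AddCommGroup W] [Module k W]

/-- A chain of minimal length `r` splits off the preinjective representation `I r`. -/
theorem nonempty_equiv_I {X : KroneckerRep k V W} (hX : X.T.IsIndecomposable) {r : ℕ} {v : ℕ → V}
    (hv : IsPencilChain X.α₁ X.α₂ r v) (hmin : ∀ m < r, ∀ v', ¬ IsPencilChain X.α₁ X.α₂ m v') :
    Nonempty (X.T.Equiv (I k r).T) := by
  classical
  obtain ⟨f, g, hfv, hgv, h₁, h₂⟩ : ∃ (f : Fin (r + 1) → Module.Dual k V)
      (g : Fin r → Module.Dual k W),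
      (∀ i j : Fin (r + 1), f i (v j) = if i = j then 1 else 0) ∧
      (∀ i j : Fin r, g i (X.α₁ (v j)) = if i = j then 1 else 0) ∧
      (∀ i : Fin r, ∀ x, g i (X.α₁ x) = f i.castSucc x) ∧
      (∀ i : Fin r, ∀ x, g i (X.α₂ x) = f i.succ x) := by
    -- For `r = 0` there are no functionals on `W`, and any `f` with `f v₀ = 1` works. Otherwise the
    -- `f`s are the pullbacks of the `g`s along `α₁` and `α₂`, which agree where they overlap.
    rcases r with _ | m
    · obtain ⟨f, hf⟩ := Module.Projective.exists_dual_eq_one k hv.ne_zero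
      refine ⟨fun _ => f, fun i => i.elim0, fun i j => ?_, fun i => i.elim0, fun i => i.elim0,
        fun i => i.elim0⟩
      obtain rfl : i = j := by omega
      have hi : (i : ℕ) = 0 := by omega
      simpa [hi] using hf
    · obtain ⟨g, hg, hgv⟩ := hv.exists_dual (hmin m (by omega))
      have hgv' : ∀ i j : Fin (m + 1), g i (X.α₁ (v j)) = if i = j then 1 else 0 := fun i j => by
        rw [hgv i (by omega) j (by omega)]
        simp [Fin.ext_iff]
      refine ⟨Fin.cons (g 0 ∘ₗ X.α₁) fun i => g i ∘ₗ X.α₂, fun i => g i, fun i j => ?_, hgv',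
        fun i x => ?_, fun i x => rfl⟩
      · refine Fin.cases ?_ (fun i => ?_) i
        · refine Fin.lastCases ?_ (fun j => ?_) j
          · simp [hv.last]
          · simpa [Fin.ext_iff] using hgv' 0 j
        · refine Fin.cases ?_ (fun j => ?_) j
          · simp [hv.first]
          · simpa [hv.step j (by omega)] using hgv' i j
      · refine Fin.cases rfl (fun i => ?_) i
        simpa [← Fin.succ_castSucc] using (hg i i.2 x).symm
  refine nonempty_equiv_of_retract hX
    (Fintype.linearCombination k fun i : Fin (r + 1) => v i)
    (Fintype.linearCombination k fun i : Fin r => X.α₁ (v i)) (LinearMap.pi f) (LinearMap.pi g)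
    (fun x => ?_) (fun x => ?_) (fun x => ?_) (fun x => ?_) ?_ ?_
  · simp [Fintype.linearCombination_apply, Fin.sum_univ_castSucc, hv.last]
  · simp [Fintype.linearCombination_apply, Fin.sum_univ_succ, hv.first, hv.step]
  · ext i; simp [h₁]
  · ext i; simp [h₂]
  · simp_rw [Fintype.pi_linearCombination_of_dual _ f hfv]
    exact Function.bijective_id
  · simp_rw [Fintype.pi_linearCombination_of_dual _ g hgv]
    exact Function.bijective_id

/-- A chain of functionals of minimal length `r` splits off the preprojective representation
`P r`. -/
theorem nonempty_equiv_P [FiniteDimensional k V] {X : KroneckerRep k V W}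
    (hX : X.T.IsIndecomposable) {m : ℕ} {g : ℕ → Module.Dual k W}
    (hg : IsPencilChain X.α₁.dualMap X.α₂.dualMap (m + 1) g)
    (hmin : ∀ g', ¬ IsPencilChain X.α₁.dualMap X.α₂.dualMap m g') :
    Nonempty (X.T.Equiv (P k (m + 1)).T) := by
  classical
  obtain ⟨y, hy, hyg⟩ := hg.exists_dual hmin
  -- The dual family of a chain in the transposed pencil lies in the bidual of `V`; by reflexivity
  -- it consists of vectors.
  let x (i : ℕ) : V := (Module.evalEquiv k V).symm (y i)
  have hx : ∀ i (f : Module.Dual k V), y i f = f (x i) := fun i f => by simp [x]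
  have hstep : ∀ i < m, X.α₂ (x i) = X.α₁ (x (i + 1)) := fun i hi => by
    refine sub_eq_zero.1 ((Module.forall_dual_apply_eq_zero_iff k _).1 fun f => ?_)
    rw [map_sub, sub_eq_zero]
    simpa [hx] using hy i hi f
  have hdual : ∀ i j : Fin (m + 1), g i (X.α₁ (x j)) = if i = j then 1 else 0 := fun i j => by
    have := hyg j (by omega) i (by omega)
    rw [hx] at this
    rw [← LinearMap.dualMap_apply, this]
    simp [Fin.ext_iff, eq_comm]
  have hlast : ∀ z, g (m + 1) (X.α₁ z) = 0 := fun z => LinearMap.congr_fun hg.last z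
  have hfirst : ∀ z, g 0 (X.α₂ z) = 0 := fun z => LinearMap.congr_fun hg.first z
  have hgs : ∀ i : Fin (m + 1), ∀ z, g (i + 1) (X.α₂ z) = g i (X.α₁ z) :=
    fun i z => LinearMap.congr_fun (hg.step i i.2) z
  -- Since `α₂ xᵢ = α₁ xᵢ₊₁`, the images under both maps overlap and leave `m + 2` vectors, dual to
  -- `g₀, …, gₘ₊₁`.
  let y' : Fin (m + 2) → W := Fin.cons (X.α₁ (x 0)) fun i => X.α₂ (x i)
  have hy' : ∀ i : Fin (m + 1), y' i.castSucc = X.α₁ (x i) := fun i => by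
    refine Fin.cases rfl (fun i => ?_) i
    simpa [y', ← Fin.succ_castSucc] using hstep i i.2
  refine nonempty_equiv_of_retract hX
    (Fintype.linearCombination k fun i : Fin (m + 1) => x i)
    (Fintype.linearCombination k y')
    (LinearMap.pi fun i : Fin (m + 1) => g i ∘ₗ X.α₁) (LinearMap.pi fun i : Fin (m + 2) => g i)
    (fun z => ?_) (fun z => ?_) (fun z => ?_) (fun z => ?_) ?_ ?_
  · rw [Fintype.linearCombination_apply, Fintype.linearCombination_apply, Fin.sum_univ_castSucc]
    simp [hy']
  · rw [Fintype.linearCombination_apply, Fintype.linearCombination_apply, Fin.sum_univ_succ]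
    simp [y']
  · ext i
    refine Fin.lastCases ?_ (fun i => ?_) i <;> simp [hlast]
  · ext i
    refine Fin.cases ?_ (fun i => ?_) i <;> simp [hfirst, hgs]
  · simp_rw [Fintype.pi_linearCombination_of_dual (fun i : Fin (m + 1) => x i)
      (fun i : Fin (m + 1) => g i ∘ₗ X.α₁) hdual]
    exact Function.bijective_id
  · have : ∀ i j : Fin (m + 2), g i (y' j) = if i = j then 1 else 0 := fun i j => by
      refine Fin.cases ?_ (fun j => ?_) j
      · refine Fin.lastCases ?_ (fun i => ?_) i
        · simp [y', hlast]
        · have h0 : i.castSucc = 0 ↔ i = 0 := Fin.castSucc_inj (b := 0)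
          exact (hdual i 0).trans (if_congr h0 rfl rfl).symm
      · refine Fin.cases ?_ (fun i => ?_) i
        · rw [if_neg (Fin.succ_ne_zero j).symm]
          exact hfirst _
        · simpa [y', hgs] using hdual i j
    simp_rw [Fintype.pi_linearCombination_of_dual y' (fun i : Fin (m + 2) => g i) this]
    exact Function.bijective_id

end KroneckerRep

/-! ### Jordan blocks as retracts of an endomorphism -/

section Jordan

variable {k V : Type*} [Field k] [AddCommGroup V] [Module k V]

theorem jordanBlock_apply_eq (p : ℕ) (μ : k) (i j : Fin p) :
    jordanBlock p μ i j = (if i = j then μ else 0) + if (j : ℕ) = i + 1 then 1 else 0 := by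
  rw [jordanBlock, Matrix.of_apply]
  split_ifs with h₁ h₂ <;> simp_all

theorem toLin'_jordanBlock_castSucc (q : ℕ) (μ : k) (x : Fin (q + 1) → k) (i : Fin q) :
    Matrix.toLin' (jordanBlock (q + 1) μ) x i.castSucc = μ * x i.castSucc + x i.succ := by
  have : ∀ j : Fin (q + 1), (j : ℕ) = i + 1 ↔ j = i.succ := fun j => by simp [Fin.ext_iff]
  simp [Matrix.mulVec, dotProduct, jordanBlock_apply_eq, add_mul, Finset.sum_add_distrib, this]

theorem toLin'_jordanBlock_last (q : ℕ) (μ : k) (x : Fin (q + 1) → k) :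
    Matrix.toLin' (jordanBlock (q + 1) μ) x (Fin.last q) = μ * x (Fin.last q) := by
  have : ∀ j : Fin (q + 1), (j : ℕ) ≠ q + 1 := fun j => by omega
  simp [Matrix.mulVec, dotProduct, jordanBlock_apply_eq, this]

/-- Every eigenvalue of an endomorphism of a finite-dimensional space has a Jordan block as a
retract. -/
theorem Module.End.exists_jordanBlock_retract [FiniteDimensional k V] (φ : Module.End k V) (μ : k)
    (h : φ.HasEigenvalue μ) :
    ∃ (q : ℕ) (s : (Fin (q + 1) → k) →ₗ[k] V) (r : V →ₗ[k] (Fin (q + 1) → k)),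
      (∀ x, s (Matrix.toLin' (jordanBlock (q + 1) μ) x) = φ (s x)) ∧
      (∀ x, r (φ x) = Matrix.toLin' (jordanBlock (q + 1) μ) (r x)) ∧
      Function.Bijective fun x => r (s x) := by
  classical
  let N : Module.End k V := φ - algebraMap k _ μ
  have hφ : ∀ x, φ x = μ • x + N x := fun x => by simp [N]
  -- Fitting's lemma gives such a `p`. The least one, `q + 1`, is the size of a smallest Jordan
  -- block for `μ`: some kernel vector of `N` is of the form `N ^ q v` but not in the image of `N ^
  -- (q + 1)`.
  have hex : ∃ p, Disjoint (LinearMap.ker N) (LinearMap.range (N ^ p)) := by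
    obtain ⟨n, hn⟩ := (N.eventually_disjoint_ker_pow_range_pow.and
      (Filter.eventually_ge_atTop 1)).exists
    refine ⟨n, hn.1.mono_left fun x hx => ?_⟩
    obtain ⟨m, rfl⟩ := Nat.exists_eq_add_of_le' hn.2
    rw [LinearMap.mem_ker] at hx ⊢
    rw [pow_succ, Module.End.mul_apply, hx, map_zero]
  obtain ⟨q, hq⟩ : ∃ q, Nat.find hex = q + 1 := by
    refine Nat.exists_eq_succ_of_ne_zero fun h0 => ?_
    have h1 := Nat.find_spec hex
    rw [h0, pow_zero] at h1
    obtain ⟨x, hx⟩ := h.exists_hasEigenvector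
    refine hx.2 (Submodule.disjoint_def.1 h1 x ?_ ⟨x, rfl⟩)
    rw [LinearMap.mem_ker]
    simp [N, hx.apply_eq_smul]
  have hdisj := Nat.find_spec hex
  have hmin := Nat.find_min hex (m := q) (by omega)
  rw [hq] at hdisj
  rw [Submodule.disjoint_def] at hmin hdisj
  push Not at hmin
  obtain ⟨_, hker, ⟨v, rfl⟩, hne⟩ := hmin
  obtain ⟨f, hf, hfr⟩ := Submodule.exists_le_ker_of_notMem fun hm => hne (hdisj _ hker hm)
  have hNv : ∀ n, q < n → (N ^ n) v = 0 := by
    intro n hn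
    obtain ⟨d, rfl⟩ := Nat.exists_eq_add_of_lt hn
    rw [show q + d + 1 = d + (1 + q) by ring, pow_add, pow_add, pow_one, Module.End.mul_apply,
      Module.End.mul_apply, LinearMap.mem_ker.1 hker, map_zero]
  have hfN : ∀ x, f ((N ^ (q + 1)) x) = 0 := fun x => hfr ⟨x, rfl⟩
  have hsucc : ∀ n x, N ((N ^ n) x) = (N ^ (n + 1)) x := fun n x => by
    rw [pow_succ', Module.End.mul_apply]
  have hsucc' : ∀ n x, (N ^ n) (N x) = (N ^ (n + 1)) x := fun n x => by
    rw [pow_succ, Module.End.mul_apply]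
  -- `s` sends the standard basis to the Jordan chain of `v`, and `r` records `f` along powers of
  -- `N`. They respect the last row and first column since `f` kills the image of `N ^ (q + 1)` and
  -- `N ^ (q + 1) v = 0`.
  let s := Fintype.linearCombination k fun i : Fin (q + 1) => (N ^ (q - i)) v
  let r : V →ₗ[k] (Fin (q + 1) → k) := LinearMap.pi fun i => f ∘ₗ (N ^ (i : ℕ))
  refine ⟨q, s, r, fun x => ?_, fun x => ?_, ?_⟩
  · rw [hφ, Fintype.linearCombination_apply, Fintype.linearCombination_apply, map_sum,
      Fin.sum_univ_castSucc, Fin.sum_univ_succ (fun i => N _), Finset.smul_sum,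
      Fin.sum_univ_castSucc (fun i => μ • _)]
    have hi : ∀ i : Fin q, q - (i + 1) + 1 = q - i := fun i => by omega
    simp [toLin'_jordanBlock_castSucc, toLin'_jordanBlock_last, hsucc, hNv, hi, add_smul,
      mul_smul, Finset.sum_add_distrib]
    abel
  · ext i
    refine Fin.lastCases ?_ (fun i => ?_) i
    · simp [toLin'_jordanBlock_last, r, hφ, hsucc', hfN]
    · simp [toLin'_jordanBlock_castSucc, r, hφ, hsucc']
  -- The composite need not be the identity, but it is upper triangular with diagonal entries `f (N
  -- ^ q v) ≠ 0`.
  · let M : Matrix (Fin (q + 1)) (Fin (q + 1)) k :=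
      Matrix.of fun i j => f ((N ^ ((i : ℕ) + (q - j))) v)
    have hM : M.det ≠ 0 := by
      rw [Matrix.det_of_isUpperTriangular]
      · refine Finset.prod_ne_zero_iff.2 fun i _ => ?_
        simpa [M, show (i : ℕ) + (q - i) = q by omega] using hf
      · intro i j hij
        have hij : j < i := hij
        simp only [M, Matrix.of_apply]
        rw [hNv _ (by omega), map_zero]
    have hrs : (fun x => r (s x)) = Matrix.toLin' M := by
      funext x
      ext i
      simp [s, r, M, Fintype.linearCombination_apply, Matrix.mulVec, dotProduct, pow_add,
        mul_comm]
    rw [hrs]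
    exact (LinearMap.equivOfDetNeZero (Matrix.toLin' M) (by rwa [LinearMap.det_toLin'])).bijective

end Jordan

/-! ### Pencils with an invertible member, and the classification of pencils -/

namespace KroneckerRep

variable {k : Type u} {V : Type v} {W : Type w} [Field k] [CharP k 2] [AddCommGroup V]
  [Module k V] [AddCommGroup W] [Module k W]

/-- Identifying `W` with `V` through `α₂` turns the pencil into `(φ, id)`, so a Jordan block of `φ`
is a retract of the pencil. -/
theorem nonempty_equiv_R_affine [FiniteDimensional k V] {X : KroneckerRep k V W}
    (hX : X.T.IsIndecomposable) (e : V ≃ₗ[k] W) (he : X.α₂ = e) {μ : k}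
    (hμ : Module.End.HasEigenvalue (e.symm.toLinearMap ∘ₗ X.α₁) μ) (h : ![μ, 1] ≠ 0) :
    ∃ q, Nonempty (X.T.Equiv (R (q + 1) (Projectivization.mk k ![μ, 1] h)).T) := by
  obtain ⟨q, s, r, hs, hr, hrs⟩ := Module.End.exists_jordanBlock_retract _ _ hμ
  refine ⟨q, ?_⟩
  rw [R_affine]
  refine nonempty_equiv_of_retract hX s (e.toLinearMap ∘ₗ s) r (r ∘ₗ e.symm.toLinearMap)
    (fun x => ?_) (fun x => ?_) (fun x => ?_) (fun x => ?_) hrs (by simpa using hrs)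
  · simp [-Matrix.toLin'_apply, hs]
  · simp [he]
  · simpa using hr x
  · simp [he]

theorem nonempty_equiv_R_infinity [FiniteDimensional k V] {X : KroneckerRep k V W}
    (hX : X.T.IsIndecomposable) (e : V ≃ₗ[k] W) (he : X.α₁ = e)
    (hμ : Module.End.HasEigenvalue (e.symm.toLinearMap ∘ₗ X.α₂) 0) (h : ![(1 : k), 0] ≠ 0) :
    ∃ q, Nonempty (X.T.Equiv (R (q + 1) (Projectivization.mk k ![1, 0] h)).T) := by
  obtain ⟨q, s, r, hs, hr, hrs⟩ := Module.End.exists_jordanBlock_retract _ _ hμ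
  refine ⟨q, ?_⟩
  rw [R_infinity]
  refine nonempty_equiv_of_retract hX s (e.toLinearMap ∘ₗ s) r (r ∘ₗ e.symm.toLinearMap)
    (fun x => ?_) (fun x => ?_) (fun x => ?_) (fun x => ?_) hrs (by simpa using hrs)
  · simp [he]
  · simp [-Matrix.toLin'_apply, hs]
  · simp [he]
  · simpa using hr x

/-- If `α₂ = c + t α₁` with `c` invertible, then a decomposition of `V` that is stable under
`c⁻¹ α₁` is trivial. -/
theorem eq_bot_or_eq_bot_of_isCompl {X : KroneckerRep k V W} (hX : X.T.IsIndecomposable)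
    (c : V ≃ₗ[k] W) (t : k) (φ : Module.End k V) (h₁ : ∀ x, X.α₁ x = c (φ x))
    (h₂ : ∀ x, X.α₂ x = c (x + t • φ x)) {K L : Submodule k V} (hKL : IsCompl K L)
    (hK : ∀ x ∈ K, φ x ∈ K) (hL : ∀ x ∈ L, φ x ∈ L) : K = ⊥ ∨ L = ⊥ := by
  let S (U : Submodule k V) (hU : ∀ x ∈ U, φ x ∈ U) : Subrepresentation X.T :=
    KleinFour.subrepresentation (U.prod (U.map (c : V →ₗ[k] W)))
      (fun z hz => by
        rw [T_g₁_apply, h₁]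
        exact ⟨hz.1, add_mem hz.2 (Submodule.mem_map_of_mem (hU _ hz.1))⟩)
      (fun z hz => by
        rw [T_g₂_apply, h₂]
        exact ⟨hz.1, add_mem hz.2
          (Submodule.mem_map_of_mem (add_mem hz.1 (U.smul_mem t (hU _ hz.1))))⟩)
  have hmap : IsCompl (K.map (c : V →ₗ[k] W)) (L.map (c : V →ₗ[k] W)) :=
    hKL.map (Submodule.orderIsoMapComap c)
  have hc : IsCompl (S K hK) (S L hL) := by
    rw [← Subrepresentation.isCompl_toSubmodule, isCompl_iff, disjoint_iff, codisjoint_iff]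
    change K.prod _ ⊓ L.prod _ = ⊥ ∧ K.prod _ ⊔ L.prod _ = ⊤
    rw [Submodule.prod_inf_prod, Submodule.prod_sup_prod, hKL.inf_eq_bot, hKL.sup_eq_top,
      hmap.inf_eq_bot, hmap.sup_eq_top, Submodule.prod_bot, Submodule.prod_top]
    exact ⟨rfl, rfl⟩
  have hbot : ∀ U hU, S U hU = ⊥ → U = ⊥ := fun U hU h => by
    rw [← Subrepresentation.toSubmodule_eq_bot] at h
    refine (Submodule.eq_bot_iff _).2 fun x hx => ?_
    have : (x, (0 : W)) ∈ (S U hU).toSubmodule := ⟨hx, zero_mem _⟩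
    rw [h, Submodule.mem_bot] at this
    exact congrArg Prod.fst this
  exact (hX.2 _ _ hc).imp (hbot K hK) (hbot L hL)

/-- A Kronecker representation with a member of the pencil invertible and with indecomposable
image under `T` is regular. -/
theorem exists_equiv_R [IsAlgClosed k] [FiniteDimensional k V] {X : KroneckerRep k V W}
    (hX : X.T.IsIndecomposable) (c : V ≃ₗ[k] W) (t : k) (hc : X.α₂ - t • X.α₁ = c) :
    ∃ q l, Nonempty (X.T.Equiv (R (q + 1) l).T) := by
  have : Nontrivial V := by
    by_contra hV
    rw [not_nontrivial_iff_subsingleton] at hV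
    have := c.symm.toEquiv.subsingleton
    exact not_subsingleton_iff_nontrivial.2 hX.1 inferInstance
  let φ : Module.End k V := c.symm.toLinearMap ∘ₗ X.α₁
  have h₁ : ∀ x, X.α₁ x = c (φ x) := fun x => by simp [φ]
  have h₂ : ∀ x, X.α₂ x = c (x + t • φ x) := fun x => by
    rw [map_add, map_smul, ← h₁, ← LinearEquiv.coe_coe, ← hc]
    simp
  by_cases hb : Function.Injective (1 + t • φ : Module.End k V)
  · let e : V ≃ₗ[k] W := (LinearEquiv.ofInjectiveEndo _ hb).trans c
    obtain ⟨μ, hμ⟩ := Module.End.exists_eigenvalue (e.symm.toLinearMap ∘ₗ X.α₁)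
    obtain ⟨q, hq⟩ := nonempty_equiv_R_affine hX e (LinearMap.ext h₂) hμ (by simp)
    exact ⟨q, _, hq⟩
  -- By the Fitting decomposition, `φ` is injective or nilpotent; if it were nilpotent, `1 + t φ`
  -- would be invertible.
  · have hφ : Function.Injective φ := by
      obtain ⟨n, hn⟩ := (φ.eventually_isCompl_ker_pow_range_pow.and
        (Filter.eventually_ge_atTop 1)).exists
      have hcomm : ∀ x, (φ ^ n) (φ x) = φ ((φ ^ n) x) := fun x => by
        rw [← Module.End.mul_apply, ← Module.End.mul_apply, ← pow_succ, pow_succ']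
      rcases eq_bot_or_eq_bot_of_isCompl hX c t φ h₁ h₂ hn.1
        (fun x hx => by
          rw [LinearMap.mem_ker] at hx ⊢
          rw [hcomm, hx, map_zero])
        (by rintro _ ⟨x, rfl⟩; exact ⟨φ x, hcomm x⟩) with h | h
      · refine LinearMap.ker_eq_bot.1 (eq_bot_iff.2 (le_trans (fun x hx => ?_) h.le))
        obtain ⟨m, rfl⟩ := Nat.exists_eq_add_of_le' hn.2
        rw [LinearMap.mem_ker] at hx ⊢
        rw [pow_succ, Module.End.mul_apply, hx, map_zero]
      · have hnil : IsNilpotent (t • φ) := by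
          refine IsNilpotent.smul ⟨n, LinearMap.range_eq_bot.1 h⟩ t
        exact absurd ((Module.End.isUnit_iff _).1 hnil.isUnit_one_add).1 hb
    let e : V ≃ₗ[k] W := (LinearEquiv.ofInjectiveEndo _ hφ).trans c
    have hμ : Module.End.HasEigenvalue (e.symm.toLinearMap ∘ₗ X.α₂) 0 := by
      obtain ⟨x, hx, hx0⟩ : ∃ x, (1 + t • φ : Module.End k V) x = 0 ∧ x ≠ 0 := by
        rw [← LinearMap.ker_eq_bot, LinearMap.ker_eq_bot'] at hb
        push Not at hb
        exact hb
      refine Module.End.hasEigenvalue_of_hasEigenvector (x := x)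
        ⟨Module.End.mem_eigenspace_iff.2 ?_, hx0⟩
      have : x + t • φ x = 0 := hx
      rw [LinearMap.comp_apply, h₂, this]
      simp
    obtain ⟨q, hq⟩ := nonempty_equiv_R_infinity hX e (LinearMap.ext h₁) hμ (by simp)
    exact ⟨q, _, hq⟩

/-- The classification of Kronecker representations `X` without simple summand at the second
vertex for which `T X` is indecomposable. -/
theorem exists_kleinIndex [IsAlgClosed k] [FiniteDimensional k V] [FiniteDimensional k W]
    {X : KroneckerRep k V W} (hX : X.T.IsIndecomposable)
    (hW : ∀ g : Module.Dual k W, g ∘ₗ X.α₁ = 0 → g ∘ₗ X.α₂ = 0 → g = 0) :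
    ∃ i : KleinIndex k, Nonempty (X.T.Equiv (kleinRep i).ρ) := by
  classical
  by_cases hI : ∃ r v, IsPencilChain X.α₁ X.α₂ r v
  · obtain ⟨v, hv⟩ := Nat.find_spec hI
    exact ⟨.preinjective _, nonempty_equiv_I hX hv fun m hm v' hv' =>
      Nat.find_min hI hm ⟨v', hv'⟩⟩
  by_cases hP : ∃ r g, IsPencilChain X.α₁.dualMap X.α₂.dualMap r g
  · obtain ⟨g, hg⟩ := Nat.find_spec hP
    rcases hm : Nat.find hP with _ | m
    -- A dual chain of length 0 is a functional that kills both images, which `hW` excludes; this is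
    -- where the missing `TP_0` is accounted for.
    · rw [hm] at hg
      exact absurd (hW _ hg.last hg.first) hg.ne_zero
    · rw [hm] at hg
      exact ⟨.preprojective (m + 1) (by omega), nonempty_equiv_P hX hg fun g' hg' =>
        Nat.find_min hP (m := m) (by omega) ⟨g', hg'⟩⟩
  push Not at hI hP
  -- Otherwise the transposed pencil, being without chains, has an injective member, which forces
  -- this very inequality.
  have hle : Module.finrank k W ≤ Module.finrank k V := by
    by_contra! hlt
    obtain ⟨t, ht⟩ := exists_injective_of_no_pencilChain X.α₁.dualMap X.α₂.dualMap
      (by simpa only [Subspace.dual_finrank_eq] using hlt.le) hP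
    have := LinearMap.finrank_le_finrank_of_injective ht
    rw [Subspace.dual_finrank_eq, Subspace.dual_finrank_eq] at this
    omega
  obtain ⟨t, ht⟩ := exists_injective_of_no_pencilChain X.α₁ X.α₂ hle hI
  obtain ⟨q, l, h⟩ := exists_equiv_R hX (LinearEquiv.ofBijective _ ⟨ht,
    (LinearMap.injective_iff_surjective_of_finrank_eq_finrank
      (le_antisymm (LinearMap.finrank_le_finrank_of_injective ht) hle)).1 ht⟩) t (LinearMap.ext fun x => rfl)
  exact ⟨.tube (q + 1) (by omega) l, h⟩

end KroneckerRep

/-! ### The regular representation and the reduction to pencils -/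

namespace KleinFour

open Representation

theorem sum_univ {M : Type*} [AddCommMonoid M] (F : KleinFour → M) :
    ∑ g, F g = F 1 + (F g₁ + (F g₂ + F (g₁ * g₂))) := by
  have h : (Finset.univ : Finset KleinFour) = {1, g₁, g₂, g₁ * g₂} := by decide
  rw [h, Finset.sum_insert (by decide), Finset.sum_insert (by decide),
    Finset.sum_insert (by decide), Finset.sum_singleton]

section Loops

variable {k V : Type*} [Field k] [AddCommGroup V] [Module k V]
  (ρ : Representation k KleinFour V)

theorem loop_comm (x : V) :
    (ρ g₁ - 1) ((ρ g₂ - 1) x) = (ρ g₂ - 1) ((ρ g₁ - 1) x) := by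
  have h : ρ g₁ (ρ g₂ x) = ρ g₂ (ρ g₁ x) := by
    rw [← Module.End.mul_apply, ← Module.End.mul_apply, ← map_mul, ← map_mul, mul_comm]
  simp only [LinearMap.sub_apply, Module.End.one_apply, map_sub, h]
  abel

theorem loop_sq [CharP k 2] {g : KleinFour} (hg : g * g = 1) (x : V) :
    (ρ g - 1) ((ρ g - 1) x) = 0 := by
  have h : ρ g (ρ g x) = x := by
    rw [← Module.End.mul_apply, ← map_mul, hg, map_one, Module.End.one_apply]
  have h2 : (2 : k) = 0 := by exact_mod_cast CharP.cast_eq_zero k 2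
  simp only [LinearMap.sub_apply, Module.End.one_apply, map_sub, h]
  calc x - ρ g x - (ρ g x - x) = (2 : k) • (x - ρ g x) := by rw [two_smul]; abel
    _ = 0 := by rw [h2, zero_smul]

theorem leftRegularMap_apply (v : V) (x : MonoidAlgebra k KleinFour) :
    (leftRegularMapEquiv ρ).symm v x = ∑ g, x.coeff g • ρ g v := by
  simp [leftRegularMapEquiv, Finsupp.sum_fintype]

/-- An element not annihilated by `(g₁ - 1) (g₂ - 1)` generates a free module of rank one. -/
theorem leftRegularMap_injective [CharP k 2] {v : V} (hv : (ρ g₁ - 1) ((ρ g₂ - 1) v) ≠ 0) :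
    Function.Injective ((leftRegularMapEquiv ρ).symm v) := by
  rw [injective_iff_map_eq_zero]
  intro x hx
  rw [leftRegularMap_apply, sum_univ] at hx
  set A := ρ g₁ - 1 with hA
  set B := ρ g₂ - 1 with hB
  have hAA : ∀ y, A (A y) = 0 := loop_sq ρ (by decide)
  have hBB : ∀ y, B (B y) = 0 := loop_sq ρ (by decide)
  have hAB : ∀ y, A (B y) = B (A y) := loop_comm ρ
  have h₁ : ∀ y, ρ g₁ y = y + A y := fun y => by simp [hA]
  have h₂ : ∀ y, ρ g₂ y = y + B y := fun y => by simp [hB]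
  have h₃ : ρ (g₁ * g₂) v = v + A v + B v + A (B v) := by
    rw [map_mul, Module.End.mul_apply, h₂, h₁, map_add]
    abel
  rw [h₃, h₂, h₁, map_one ρ, Module.End.one_apply] at hx
  generalize hc₀ : x.coeff 1 = c₀ at hx
  generalize hc₁ : x.coeff g₁ = c₁ at hx
  generalize hc₂ : x.coeff g₂ = c₂ at hx
  generalize hc₃ : x.coeff (g₁ * g₂) = c₃ at hx
  -- In the basis `1, A, B, AB` of the group algebra, applying `AB`, `B` and `A` isolates one
  -- coefficient at a time.
  replace hx : (c₀ + c₁ + c₂ + c₃) • v + (c₁ + c₃) • A v + (c₂ + c₃) • B v + c₃ • A (B v) = 0 := by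
    rw [← hx]
    module
  have e₀ : c₀ + c₁ + c₂ + c₃ = 0 := by
    simpa [hAA, hBB, hAB, hAB v ▸ hv] using congrArg (fun y => A (B y)) hx
  rw [e₀, zero_smul, zero_add] at hx
  have e₁ : c₁ + c₃ = 0 := by
    simpa [hAA, hBB, ← hAB, hv] using congrArg B hx
  have e₂ : c₂ + c₃ = 0 := by
    simpa [hAA, hBB, hv] using congrArg A hx
  rw [e₁, e₂, zero_smul, zero_smul, zero_add, zero_add] at hx
  have e₃ : c₃ = 0 := (smul_eq_zero.1 hx).resolve_right hv
  rw [e₃, add_zero] at e₀ e₁ e₂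
  rw [e₁, e₂, add_zero, add_zero] at e₀
  refine MonoidAlgebra.coeff_injective (Finsupp.ext fun g => ?_)
  rcases cases_generators g with rfl | rfl | rfl | rfl <;> simp [*]

end Loops

theorem loop_loop_single_ne_zero {k : Type*} [Field k] :
    (leftRegular k KleinFour g₁ - 1) ((leftRegular k KleinFour g₂ - 1) (.single 1 1)) ≠ 0 := by
  intro h
  have := congrArg (fun x => x.coeff 1) h
  have n₁ : g₁ ≠ 1 := by decide
  have n₂ : g₂ ≠ 1 := by decide
  have n₃ : g₁ * g₂ ≠ 1 := by decide
  simp [n₁, n₂, n₃] at this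

section Regular

variable {k : Type u} {V : Type v} [Field k] [CharP k 2] [AddCommGroup V] [Module k V]

/-- The representation `k[G]` is injective: it splits off as soon as it embeds. -/
theorem nonempty_equiv_leftRegular {ρ : Representation k KleinFour V} (hρ : ρ.IsIndecomposable)
    {v : V} (hv : (ρ g₁ - 1) ((ρ g₂ - 1) v) ≠ 0) :
    Nonempty (ρ.Equiv (leftRegular k KleinFour)) := by
  classical
  let s := (leftRegularMapEquiv ρ).symm v
  have hs : ∀ g, s (.single g 1) = ρ g v := fun g => leftRegularMapEquiv_symm_single ρ g v
  obtain ⟨l, hl⟩ := s.toLinearMap.exists_leftInverse_of_injective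
    (LinearMap.ker_eq_bot.2 (leftRegularMap_injective ρ hv))
  let f : V →ₗ[k] k := Finsupp.lapply 1 ∘ₗ (MonoidAlgebra.coeffLinearEquiv k).toLinearMap ∘ₗ l
  have hf : ∀ g, f (ρ g v) = if g = 1 then 1 else 0 := fun g => by
    have : l (ρ g v) = .single g 1 := by
      rw [← hs]
      exact LinearMap.congr_fun hl _
    simp [f, this, Finsupp.single_apply]
  -- `k[G]` is coinduced from the trivial group, so a functional `f` extends to the intertwining map
  -- `x ↦ ∑ f(g⁻¹ x) g`. As `f` is dual to `v` in its orbit, this retracts `s`.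
  let r : ρ.IntertwiningMap (leftRegular k KleinFour) :=
    LinearMap.intertwiningMap_of_isIntertwiningMap ρ _
      ((MonoidAlgebra.coeffLinearEquiv k).symm.toLinearMap ∘ₗ
        (Finsupp.linearEquivFunOnFinite k k KleinFour).symm.toLinearMap ∘ₗ
        LinearMap.pi fun g => f ∘ₗ ρ g⁻¹) fun h x => by
      refine MonoidAlgebra.coeff_injective (Finsupp.ext fun g => ?_)
      rw [coeff_ofMulAction]
      simp
  have hr : ∀ x g, (r x).coeff g = f (ρ g⁻¹ x) := fun x g => rfl
  have hrs : r.toLinearMap ∘ₗ s.toLinearMap = LinearMap.id := by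
    ext h g
    simp [hr, hs, ← Module.End.mul_apply, ← map_mul, hf, Finsupp.single_apply, inv_mul_eq_one,
      eq_comm]
  refine hρ.nonempty_equiv_of_retract s r ?_
  have : (fun x => r (s x)) = id := funext fun x => LinearMap.congr_fun hrs x
  rw [this]
  exact Function.bijective_id

/-- In a decomposition `1 = u + w`, one of the components is not killed by `(g₁ - 1)(g₂ - 1)`. That
component generates a free submodule of full dimension, hence everything. -/
theorem isIndecomposable_leftRegular : (leftRegular k KleinFour).IsIndecomposable := by
  set ρ := leftRegular k KleinFour with hρ
  have hone := loop_loop_single_ne_zero (k := k)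
  have hgen : ∀ U : Subrepresentation ρ, ∀ u ∈ U.toSubmodule, (ρ g₁ - 1) ((ρ g₂ - 1) u) ≠ 0 →
      U = ⊤ := by
    intro U u hu hne
    have hinj := leftRegularMap_injective ρ hne
    have hsurj := (LinearMap.injective_iff_surjective
      (f := ((leftRegularMapEquiv ρ).symm u).toLinearMap)).1 hinj
    refine Subrepresentation.ext (Submodule.eq_top_iff'.2 fun y => ?_)
    obtain ⟨x, rfl⟩ := hsurj y
    change (leftRegularMapEquiv ρ).symm u x ∈ _
    rw [leftRegularMap_apply]
    exact Submodule.sum_mem _ fun g _ => U.toSubmodule.smul_mem _ (U.apply_mem_toSubmodule g hu)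
  refine ⟨inferInstance, fun U W h => ?_⟩
  obtain ⟨u, hu, w, hw, huw⟩ := Submodule.mem_sup.1
    ((Subrepresentation.isCompl_toSubmodule.2 h).sup_eq_top ▸ Submodule.mem_top :
      (.single 1 1 : MonoidAlgebra k KleinFour) ∈ U.toSubmodule ⊔ W.toSubmodule)
  by_cases hu0 : (ρ g₁ - 1) ((ρ g₂ - 1) u) = 0
  · left
    have := hgen W w hw fun hw0 => hone (by rw [← huw, map_add, map_add, hu0, hw0, add_zero])
    exact eq_bot_of_isCompl_top (this ▸ h)
  · right
    have := hgen U u hu hu0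
    exact eq_bot_of_top_isCompl (this ▸ h)

end Regular

section Trivial

variable {k : Type u} {V : Type v} [Field k] [CharP k 2] [AddCommGroup V] [Module k V]

/-- If `(g₁ - 1) (g₂ - 1)` acts as zero, then the representation comes from a Kronecker
representation. -/
theorem exists_kroneckerRep_equiv (ρ : Representation k KleinFour V)
    (h : ∀ v, (ρ g₁ - 1) ((ρ g₂ - 1) v) = 0) :
    ∃ (M N : Submodule k V) (X : KroneckerRep k M N), Nonempty (ρ.Equiv X.T) ∧
      ∀ g : Module.Dual k N, g ∘ₗ X.α₁ = 0 → g ∘ₗ X.α₂ = 0 → g = 0 := by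
  set A := ρ g₁ - 1 with hA
  set B := ρ g₂ - 1 with hB
  have hAA : ∀ y, A (A y) = 0 := loop_sq ρ (by decide)
  have hBB : ∀ y, B (B y) = 0 := loop_sq ρ (by decide)
  have hBA : ∀ y, B (A y) = 0 := fun y => by rw [← loop_comm ρ, h]
  have h₁ : ∀ y, ρ g₁ y = y + A y := fun y => by simp [hA]
  have h₂ : ∀ y, ρ g₂ y = y + B y := fun y => by simp [hB]
  let N := LinearMap.range A ⊔ LinearMap.range B
  obtain ⟨M, hMN⟩ := Submodule.exists_isCompl N
  have hAN : ∀ y ∈ N, A y = 0 := fun y hy => by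
    obtain ⟨_, ⟨p, rfl⟩, _, ⟨q, rfl⟩, rfl⟩ := Submodule.mem_sup.1 hy
    rw [map_add, hAA, h, add_zero]
  have hBN : ∀ y ∈ N, B y = 0 := fun y hy => by
    obtain ⟨_, ⟨p, rfl⟩, _, ⟨q, rfl⟩, rfl⟩ := Submodule.mem_sup.1 hy
    rw [map_add, hBA, hBB, add_zero]
  let X : KroneckerRep k M N :=
    { α₁ := (A ∘ₗ M.subtype).codRestrict N fun x => Submodule.mem_sup_left ⟨x, rfl⟩
      α₂ := (B ∘ₗ M.subtype).codRestrict N fun x => Submodule.mem_sup_right ⟨x, rfl⟩ }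
  let e := Submodule.prodEquivOfIsCompl M N hMN.symm
  have he : ∀ z, e z = z.1 + z.2 := fun z => Submodule.coe_prodEquivOfIsCompl' M N hMN.symm z
  let E : X.T.Equiv ρ := (intertwiningMap (ρ := X.T) (σ := ρ) e.toLinearMap
    (fun z => by simp [he, h₁, hAN, X]; abel)
    (fun z => by simp [he, h₂, hBN, X]; abel)).ofBijective e.bijective
  refine ⟨M, N, X, ⟨E.symm⟩, fun g hg₁ hg₂ => ?_⟩
  have hdec : ∀ y : V, ∃ x : M, ∃ n ∈ N, y = x + n := fun y => by
    obtain ⟨z, rfl⟩ := e.surjective y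
    exact ⟨z.1, z.2, z.2.2, he z⟩
  ext ⟨y, hy⟩
  obtain ⟨_, ⟨p, rfl⟩, _, ⟨q, rfl⟩, rfl⟩ := Submodule.mem_sup.1 hy
  obtain ⟨x, n, hn, rfl⟩ := hdec p
  obtain ⟨x', n', hn', rfl⟩ := hdec q
  have hx : (⟨A (x + n) + B (x' + n'), hy⟩ : N) = X.α₁ x + X.α₂ x' :=
    Subtype.ext (by simp [X, hAN n hn, hBN n' hn'])
  rw [hx, map_add, LinearMap.zero_apply]
  have e₁ : g (X.α₁ x) = 0 := LinearMap.congr_fun hg₁ x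
  have e₂ : g (X.α₂ x') = 0 := LinearMap.congr_fun hg₂ x'
  rw [e₁, e₂, add_zero]

/-- Every finite-dimensional indecomposable representation is in the list. -/
theorem exists_kleinIndex [IsAlgClosed k] [FiniteDimensional k V]
    (ρ : Representation k KleinFour V) (hρ : ρ.IsIndecomposable) :
    ∃ i : KleinIndex k, Nonempty (ρ.Equiv (kleinRep i).ρ) := by
  by_cases h : ∀ v, (ρ g₁ - 1) ((ρ g₂ - 1) v) = 0
  · obtain ⟨M, N, X, ⟨e⟩, hX⟩ := exists_kroneckerRep_equiv ρ h
    obtain ⟨i, ⟨e'⟩⟩ := KroneckerRep.exists_kleinIndex (hρ.of_equiv e) hX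
    exact ⟨i, ⟨e.trans e'⟩⟩
  · push Not at h
    obtain ⟨v, hv⟩ := h
    exact ⟨.regular, nonempty_equiv_leftRegular hρ hv⟩

end Trivial

end KleinFour

/-! ### Indecomposability of the pencils in the list -/

section Idempotent

variable {k V W : Type*} [Field k] [AddCommGroup V] [Module k V] [AddCommGroup W] [Module k W]

/-- If `e vᵢ = 0`, then `b` kills `e vᵢ₊₁`, which is therefore a multiple of `v₀`; idempotence and
`e v₀ = 0` make it zero. -/
theorem LinearMap.apply_eq_zero_of_pencil {a b : V →ₗ[k] W} {n : ℕ} {v : Fin (n + 1) → V}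
    (hker : ∀ x, b x = 0 → ∃ c : k, x = c • v 0)
    (hstep : ∀ i : Fin n, b (v i.succ) = a (v i.castSucc))
    {e : Module.End k V} {e' : Module.End k W} (he : ∀ x, e (e x) = e x)
    (ha : ∀ x, e' (a x) = a (e x)) (hb : ∀ x, e' (b x) = b (e x)) (h0 : e (v 0) = 0)
    (i : Fin (n + 1)) : e (v i) = 0 := by
  induction i using Fin.induction with
  | zero => exact h0
  | succ i ih =>
    obtain ⟨c, hc⟩ := hker (e (v i.succ)) (by rw [← hb, hstep, ha, ih, map_zero])
    rw [← he, hc, map_smul, h0, smul_zero]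

/-- An idempotent endomorphism of a pencil `(a, b)` is trivial on the source if the source is
spanned by a chain that starts with a generator of the kernel of `b`. -/
theorem LinearMap.eq_zero_or_eq_one_of_pencil {a b : V →ₗ[k] W} {n : ℕ} {v : Fin (n + 1) → V}
    (hspan : Submodule.span k (Set.range v) = ⊤) (hv : v 0 ≠ 0)
    (hker : ∀ x, b x = 0 → ∃ c : k, x = c • v 0) (hfirst : b (v 0) = 0)
    (hstep : ∀ i : Fin n, b (v i.succ) = a (v i.castSucc))
    {e : Module.End k V} {e' : Module.End k W} (he : ∀ x, e (e x) = e x)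
    (ha : ∀ x, e' (a x) = a (e x)) (hb : ∀ x, e' (b x) = b (e x)) : e = 0 ∨ e = 1 := by
  obtain ⟨c, hc⟩ := hker (e (v 0)) (by rw [← hb, hfirst, map_zero])
  have hcc : c * c = c := by
    have := he (v 0)
    rw [hc, map_smul, hc, smul_smul] at this
    exact smul_left_injective k hv this
  rcases IsIdempotentElem.iff_eq_zero_or_one.1 hcc with rfl | rfl
  swap
  · right
    refine LinearMap.ext_on_range hspan fun i => ?_
    have := LinearMap.apply_eq_zero_of_pencil (e := 1 - e) (e' := 1 - e') hker hstep
      (by simp [he]) (by simp [ha]) (by simp [hb]) (by simp [hc]) i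
    exact (sub_eq_zero.1 this).symm
  · left
    refine LinearMap.ext_on_range hspan fun i => ?_
    exact LinearMap.apply_eq_zero_of_pencil hker hstep he ha hb (by simp [hc]) i

end Idempotent

namespace KroneckerRep

section

variable {k V W : Type*} [Field k] [AddCommGroup V] [Module k V] [AddCommGroup W] [Module k W]

theorem linearMap_ext_of_range_sup {Z : Type*} [AddCommGroup Z] [Module k Z]
    {X : KroneckerRep k V W} (hW : LinearMap.range X.α₁ ⊔ LinearMap.range X.α₂ = ⊤)
    {f g : W →ₗ[k] Z} (h₁ : ∀ x, f (X.α₁ x) = g (X.α₁ x)) (h₂ : ∀ x, f (X.α₂ x) = g (X.α₂ x)) :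
    f = g := by
  ext y
  obtain ⟨_, ⟨p, rfl⟩, _, ⟨q, rfl⟩, rfl⟩ :=
    Submodule.mem_sup.1 (hW ▸ Submodule.mem_top : y ∈ _)
  rw [map_add, map_add, h₁, h₂]

/-- If `α₁` and `α₂` are jointly surjective and the idempotent endomorphisms of a Kronecker
representation `X` are trivial at the first vertex, then `T X` is indecomposable. -/
theorem isIndecomposable_T [CharP k 2] {X : KroneckerRep k V W} [Nontrivial (V × W)]
    (hW : LinearMap.range X.α₁ ⊔ LinearMap.range X.α₂ = ⊤)
    (h : ∀ (e : Module.End k V) (e' : Module.End k W), (∀ x, e (e x) = e x) →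
      (∀ x, e' (e' x) = e' x) →
      (∀ x, e' (X.α₁ x) = X.α₁ (e x)) → (∀ x, e' (X.α₂ x) = X.α₂ (e x)) → e = 0 ∨ e = 1) :
    X.T.IsIndecomposable := by
  refine ⟨inferInstance, fun U L hUL => ?_⟩
  have hc := Subrepresentation.isCompl_toSubmodule.2 hUL
  let p : Module.End k (V × W) := Submodule.projection _ _ hc
  have hpU : ∀ z, p z ∈ U.toSubmodule := fun z => Submodule.projection_apply_mem hc z
  have hpL : ∀ z, z - p z ∈ L.toSubmodule := fun z => Submodule.sub_projection_mem hc z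
  have hU : ∀ z ∈ U.toSubmodule, p z = z := fun z hz =>
    Submodule.projection_apply_of_mem_left hc hz
  have hL : ∀ z ∈ L.toSubmodule, p z = 0 := fun z hz =>
    (Submodule.projection_apply_eq_zero_iff hc).2 hz
  have hp : ∀ g z, p (X.T g z) = X.T g (p z) := fun g z => by
    conv_lhs => rw [← add_sub_cancel (p z) z, map_add, map_add]
    rw [hU _ (U.apply_mem_toSubmodule g (hpU z)), hL _ (L.apply_mem_toSubmodule g (hpL z)),
      add_zero]
  have hpp : ∀ z, p (p z) = p z := fun z => hU _ (hpU z)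
  -- `(0, α₁ x)` is `(g₁ - 1)(x, 0)`, and the projection `p` commutes with the group.
  have hp₁ : ∀ x, p (0, X.α₁ x) = (0, X.α₁ (p (x, 0)).1) := fun x => by
    have := hp KleinFour.g₁ (x, 0)
    simp only [T_g₁_apply, zero_add] at this
    rw [show ((0 : V), X.α₁ x) = (x, X.α₁ x) - (x, 0) by simp, map_sub, this]
    ext <;> simp
  have hp₂ : ∀ x, p (0, X.α₂ x) = (0, X.α₂ (p (x, 0)).1) := fun x => by
    have := hp KleinFour.g₂ (x, 0)
    simp only [T_g₂_apply, zero_add] at this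
    rw [show ((0 : V), X.α₂ x) = (x, X.α₂ x) - (x, 0) by simp, map_sub, this]
    ext <;> simp
  let e : Module.End k V := LinearMap.fst k V W ∘ₗ p ∘ₗ LinearMap.inl k V W
  let e' : Module.End k W := LinearMap.snd k V W ∘ₗ p ∘ₗ LinearMap.inr k V W
  -- Joint surjectivity makes `p` block lower triangular, so its diagonal blocks form an idempotent
  -- endomorphism of `X`.
  have h12 : LinearMap.fst k V W ∘ₗ p ∘ₗ LinearMap.inr k V W = 0 :=
    linearMap_ext_of_range_sup hW (by simp [hp₁]) (by simp [hp₂])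
  have hinr : ∀ y, p (0, y) = (0, e' y) := fun y =>
    Prod.ext (LinearMap.congr_fun h12 y) rfl
  have hinl : ∀ x, p (x, 0) = (e x, (p (x, 0)).2) := fun x => rfl
  have hadd : ∀ x y, p (x, y) = (e x, (p (x, 0)).2 + e' y) := fun x y => by
    rw [show (x, y) = (x, 0) + (0, y) by simp, map_add, hinr, hinl]
    simp
  have ha : ∀ x, e' (X.α₁ x) = X.α₁ (e x) := fun x =>
    congrArg Prod.snd ((hinr _).symm.trans (hp₁ x))
  have hb : ∀ x, e' (X.α₂ x) = X.α₂ (e x) := fun x =>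
    congrArg Prod.snd ((hinr _).symm.trans (hp₂ x))
  have hee : ∀ x, e (e x) = e x := fun x => by
    have := congrArg Prod.fst (hpp (x, 0))
    rw [hinl, hadd] at this
    exact this
  have hee' : ∀ y, e' (e' y) = e' y := fun y => by
    have := congrArg Prod.snd (hpp (0, y))
    rwa [hinr, hinr] at this
  rcases h e e' hee hee' ha hb with h0 | h1
  · left
    have h0' : e' = 0 := linearMap_ext_of_range_sup hW (by simp [ha, h0]) (by simp [hb, h0])
    refine Subrepresentation.toSubmodule_eq_bot.1 ((Submodule.eq_bot_iff _).2 fun z hz => ?_)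
    -- With zero diagonal blocks `p` squares to zero, hence `p = p² = 0`.
    rw [← hU z hz, ← hpp, hadd z.1 z.2, h0, h0', LinearMap.zero_apply, hinr, h0']
    rfl
  · right
    have h1' : e' = 1 := linearMap_ext_of_range_sup hW (by simp [ha, h1]) (by simp [hb, h1])
    refine Subrepresentation.toSubmodule_eq_bot.1 ((Submodule.eq_bot_iff _).2 fun z hz => ?_)
    have hz0 := hL z hz
    have hz' := hadd z.1 z.2
    rw [Prod.mk.eta, hz0, h1, h1'] at hz'
    have hx : z.1 = 0 := (congrArg Prod.fst hz').symm
    have hy : (0 : W) = (p (z.1, 0)).2 + z.2 := congrArg Prod.snd hz'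
    rw [hx, Prod.mk_zero_zero, map_zero] at hy
    exact Prod.ext hx (by simpa using hy.symm)

end

end KroneckerRep

section Jordan

variable {k : Type*} [Field k]

theorem toLin'_jordanBlock_eq (q : ℕ) (μ : k) (x : Fin (q + 1) → k) :
    Matrix.toLin' (jordanBlock (q + 1) μ) x =
      μ • x + Matrix.toLin' (jordanBlock (q + 1) 0) x := by
  ext i
  refine Fin.lastCases ?_ (fun i => ?_) i
  · rw [Pi.add_apply, toLin'_jordanBlock_last, toLin'_jordanBlock_last]
    simp
  · rw [Pi.add_apply, toLin'_jordanBlock_castSucc, toLin'_jordanBlock_castSucc]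
    simp

theorem toLin'_jordanBlock_zero_single_zero (q : ℕ) :
    Matrix.toLin' (jordanBlock (q + 1) (0 : k)) (Pi.single 0 1) = 0 := by
  ext i
  refine Fin.lastCases ?_ (fun i => ?_) i
  · rw [toLin'_jordanBlock_last, zero_mul, Pi.zero_apply]
  · rw [toLin'_jordanBlock_castSucc, zero_mul, zero_add, Pi.zero_apply,
      Pi.single_eq_of_ne (Fin.succ_ne_zero i)]

theorem eq_zero_of_toLin'_jordanBlock_eq_smul {q : ℕ} {μ ν : k} (h : μ ≠ ν)
    {x : Fin (q + 1) → k} (hx : Matrix.toLin' (jordanBlock (q + 1) μ) x = ν • x) : x = 0 := by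
  have hsub : μ - ν ≠ 0 := sub_ne_zero.2 h
  ext i
  rw [Pi.zero_apply]
  induction i using Fin.reverseInduction with
  | last =>
    have := congrFun hx (Fin.last q)
    rw [toLin'_jordanBlock_last, Pi.smul_apply, smul_eq_mul] at this
    exact (mul_eq_zero.1 (by linear_combination this : (μ - ν) * x (Fin.last q) = 0)).resolve_left
      hsub
  | cast i ih =>
    have := congrFun hx i.castSucc
    rw [toLin'_jordanBlock_castSucc, Pi.smul_apply, smul_eq_mul, ih] at this
    exact (mul_eq_zero.1 (by linear_combination this : (μ - ν) * x i.castSucc = 0)).resolve_left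
      hsub

/-- The standard basis is a chain for the pencil `(id, J(0))`, whose second map has kernel spanned
by the first basis vector. -/
theorem eq_zero_or_eq_one_of_commute_jordanBlock {q : ℕ} {e : Module.End k (Fin (q + 1) → k)}
    (he : ∀ x, e (e x) = e x)
    (h : ∀ x, e (Matrix.toLin' (jordanBlock (q + 1) 0) x) =
      Matrix.toLin' (jordanBlock (q + 1) 0) (e x)) : e = 0 ∨ e = 1 := by
  refine LinearMap.eq_zero_or_eq_one_of_pencil (a := LinearMap.id)
    (b := Matrix.toLin' (jordanBlock (q + 1) 0)) (v := Pi.basisFun k (Fin (q + 1)))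
    (e' := e) (Pi.basisFun k (Fin (q + 1))).span_eq ((Pi.basisFun k (Fin (q + 1))).ne_zero 0)
    (fun x hx => ⟨x 0, ?_⟩) ?_ (fun i => ?_) he (fun x => rfl) h
  · ext i
    refine Fin.cases ?_ (fun i => ?_) i
    · simp
    · have := congrFun hx i.castSucc
      rw [toLin'_jordanBlock_castSucc] at this
      simpa using this
  · rw [Pi.basisFun_apply, toLin'_jordanBlock_zero_single_zero]
  · ext j
    rw [Pi.basisFun_apply, Pi.basisFun_apply, LinearMap.id_apply]
    refine Fin.lastCases ?_ (fun j => ?_) j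
    · rw [toLin'_jordanBlock_last, zero_mul, Pi.single_eq_of_ne (Fin.castSucc_lt_last i).ne']
    · rw [toLin'_jordanBlock_castSucc]
      simp [Pi.single_apply]

end Jordan

theorem Projectivization.eq_mk_affine_or_eq_mk_infinity {k : Type*} [Field k]
    (l : Projectivization k (Fin 2 → k)) :
    (∃ (μ : k) (h : ![μ, 1] ≠ 0), l = Projectivization.mk k ![μ, 1] h) ∨
      ∃ h : ![(1 : k), 0] ≠ 0, l = Projectivization.mk k ![1, 0] h := by
  induction l using Projectivization.ind with
  | h v hv =>
    by_cases h1 : v 1 = 0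
    · refine .inr ⟨by simp, (Projectivization.mk_eq_mk_iff' _ _ _ _ _).2 ⟨v 0, ?_⟩⟩
      ext i
      fin_cases i <;> simp [h1]
    · refine .inl ⟨v 0 / v 1, by simp, (Projectivization.mk_eq_mk_iff' _ _ _ _ _).2 ⟨v 1, ?_⟩⟩
      ext i
      fin_cases i
      · simp [mul_div_cancel₀ _ h1]
      · simp

namespace KroneckerRep

variable {k : Type u} [Field k] [CharP k 2]

theorem isIndecomposable_T_I (r : ℕ) : (I k r).T.IsIndecomposable := by
  refine isIndecomposable_T ?_ fun e e' he _ ha hb => ?_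
  · have : LinearMap.range (I k r).α₁ = ⊤ := LinearMap.range_eq_top.2 fun y =>
      ⟨Fin.snoc y 0, by ext i; simp⟩
    rw [this, top_sup_eq]
  · refine LinearMap.eq_zero_or_eq_one_of_pencil (v := Pi.basisFun k (Fin (r + 1)))
      (Pi.basisFun k (Fin (r + 1))).span_eq ((Pi.basisFun k (Fin (r + 1))).ne_zero 0)
      (fun x hx => ⟨x 0, ?_⟩) ?_ (fun i => ?_) he ha hb
    · ext i
      refine Fin.cases ?_ (fun i => ?_) i
      · simp
      · have := congrFun hx i
        rw [I_α₂_apply] at this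
        simpa using this
    · ext i
      simp
    · ext j
      simp [Pi.single_apply]

theorem range_sup_range_P {k : Type*} [Field k] (m : ℕ) :
    LinearMap.range (P k (m + 1)).α₁ ⊔ LinearMap.range (P k (m + 1)).α₂ = ⊤ := by
  refine Submodule.eq_top_iff'.2 fun y => ?_
  refine Submodule.mem_sup.2 ⟨_, ⟨fun i => y i.castSucc, rfl⟩, _,
    ⟨Pi.single (Fin.last m) (y (Fin.last _)), rfl⟩, ?_⟩
  ext i
  refine Fin.lastCases ?_ (fun i => ?_) i
  · rw [Pi.add_apply, P_α₁_last, ← Fin.succ_last, P_α₂_succ]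
    simp
  · rw [Pi.add_apply, P_α₁_castSucc]
    refine Fin.cases ?_ (fun i => ?_) i
    · simp
    · rw [← Fin.succ_castSucc, P_α₂_succ, Pi.single_eq_of_ne (Fin.castSucc_lt_last i).ne,
        add_zero]

/-- Both maps of `P` are injective, so the chain argument is applied to the transposed pencil, with
the dual basis as chain. Injectivity of `α₁` then carries the conclusion from `e'` to `e`. -/
theorem isIndecomposable_T_P (m : ℕ) : (P k (m + 1)).T.IsIndecomposable := by
  refine isIndecomposable_T (range_sup_range_P m) fun e e' he he' ha hb => ?_
  have hα₂ : ∀ i, (P k (m + 1)).α₂ (Pi.single i 1) = Pi.single i.succ 1 := fun i => by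
    ext j
    refine Fin.cases ?_ (fun j => ?_) j
    · simp [(Fin.succ_ne_zero i).symm]
    · simp [Pi.single_apply]
  have hinj : ∀ x, (P k (m + 1)).α₁ x = 0 → x = 0 := fun x hx => by
    ext i
    rw [← P_α₁_castSucc (m + 1) x i, hx]
    rfl
  have key := LinearMap.eq_zero_or_eq_one_of_pencil (a := (P k (m + 1)).α₁.dualMap)
    (b := (P k (m + 1)).α₂.dualMap) (v := (Pi.basisFun k (Fin (m + 2))).dualBasis)
    (e := e'.dualMap) (e' := e.dualMap)
    (Pi.basisFun k (Fin (m + 2))).dualBasis.span_eq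
    ((Pi.basisFun k (Fin (m + 2))).dualBasis.ne_zero 0)
    (fun g hg => ⟨g (Pi.single 0 1), (Pi.basisFun k (Fin (m + 2))).ext fun i => by
      refine Fin.cases ?_ (fun i => ?_) i
      · simp
      · have := LinearMap.congr_fun hg (Pi.single i 1)
        rw [LinearMap.dualMap_apply, hα₂] at this
        simpa using this⟩)
    (LinearMap.ext fun x => by simp) (fun i => LinearMap.ext fun x => by simp)
    (fun g => LinearMap.ext fun x => by simp [he'])
    (fun g => LinearMap.ext fun x => by simp [ha])
    (fun g => LinearMap.ext fun x => by simp [hb])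
  rcases key with h | h
  · left
    have h' : e' = 0 := LinearMap.ext fun x => funext fun i =>
      LinearMap.congr_fun (LinearMap.congr_fun h (LinearMap.proj i)) x
    exact LinearMap.ext fun x => hinj _ (by rw [← ha, h', LinearMap.zero_apply])
  · right
    have h' : e' = 1 := LinearMap.ext fun x => funext fun i =>
      LinearMap.congr_fun (LinearMap.congr_fun h (LinearMap.proj i)) x
    refine LinearMap.ext fun x => sub_eq_zero.1 (hinj _ ?_)
    rw [map_sub, ← ha, h', Module.End.one_apply, Module.End.one_apply, sub_self]

theorem isIndecomposable_T_R (q : ℕ) (l : Projectivization k (Fin 2 → k)) :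
    (R (q + 1) l).T.IsIndecomposable := by
  rcases l.eq_mk_affine_or_eq_mk_infinity with ⟨μ, h, rfl⟩ | ⟨h, rfl⟩
  · rw [R_affine]
    refine isIndecomposable_T (by simp [LinearMap.range_id]) fun e e' he _ ha hb => ?_
    obtain rfl : e' = e := LinearMap.ext hb
    refine eq_zero_or_eq_one_of_commute_jordanBlock he fun x => ?_
    have := ha x
    simp only [toLin'_jordanBlock_eq q μ] at this
    simpa [-Matrix.toLin'_apply] using this
  · rw [R_infinity]
    refine isIndecomposable_T (by simp [LinearMap.range_id]) fun e e' he _ ha hb => ?_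
    obtain rfl : e' = e := LinearMap.ext ha
    exact eq_zero_or_eq_one_of_commute_jordanBlock he hb

end KroneckerRep

/-! ### Pairwise non-isomorphism -/

namespace KroneckerRep

section

variable {k V W V' W' : Type*} [Field k] [CharP k 2] [AddCommGroup V] [Module k V]
  [AddCommGroup W] [Module k W] [AddCommGroup V'] [Module k V'] [AddCommGroup W'] [Module k W']

theorem equiv_apply_α₁ {X : KroneckerRep k V W} {Y : KroneckerRep k V' W'} (e : X.T.Equiv Y.T)
    (x : V) : e (0, X.α₁ x) = (0, Y.α₁ (e (x, 0)).1) := by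
  have h : e (X.T KleinFour.g₁ (x, 0)) = Y.T KleinFour.g₁ (e (x, 0)) :=
    Representation.IntertwiningMap.isIntertwining X.T Y.T e.toIntertwiningMap _ _
  rw [T_g₁_apply, T_g₁_apply, zero_add] at h
  rw [show ((0 : V), X.α₁ x) = (x, X.α₁ x) - (x, 0) by simp, map_sub, h]
  ext <;> simp

theorem equiv_apply_α₂ {X : KroneckerRep k V W} {Y : KroneckerRep k V' W'} (e : X.T.Equiv Y.T)
    (x : V) : e (0, X.α₂ x) = (0, Y.α₂ (e (x, 0)).1) := by
  have h : e (X.T KleinFour.g₂ (x, 0)) = Y.T KleinFour.g₂ (e (x, 0)) :=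
    Representation.IntertwiningMap.isIntertwining X.T Y.T e.toIntertwiningMap _ _
  rw [T_g₂_apply, T_g₂_apply, zero_add] at h
  rw [show ((0 : V), X.α₂ x) = (x, X.α₂ x) - (x, 0) by simp, map_sub, h]
  ext <;> simp

/-- If `c α₁ + d α₂` is injective for `Y`, then its kernel for `X` is killed by `α₁` and `α₂`. -/
theorem apply_eq_zero_of_equiv {X : KroneckerRep k V W} {Y : KroneckerRep k V' W'}
    (e : X.T.Equiv Y.T) (c d : k) (hY : ∀ x, c • Y.α₁ x + d • Y.α₂ x = 0 → x = 0) {x : V}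
    (hx : c • X.α₁ x + d • X.α₂ x = 0) : X.α₁ x = 0 ∧ X.α₂ x = 0 := by
  -- An isomorphism need not preserve `V`, but its `V`-component on `V` intertwines the pencils
  -- modulo the effect of `e` on `W`.
  have h0 : (e (x, 0)).1 = 0 := by
    apply hY
    have : e (0, c • X.α₁ x + d • X.α₂ x) =
        (0, c • Y.α₁ (e (x, 0)).1 + d • Y.α₂ (e (x, 0)).1) := by
      rw [show ((0 : V), c • X.α₁ x + d • X.α₂ x) = c • (0, X.α₁ x) + d • (0, X.α₂ x) by simp,
        map_add, map_smul, map_smul, equiv_apply_α₁, equiv_apply_α₂]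
      simp
    rw [hx, Prod.mk_zero_zero, map_zero] at this
    exact (congrArg Prod.snd this).symm
  have inj : ∀ y : W, e (0, y) = 0 → y = 0 := fun y hy =>
    congrArg Prod.snd (e.toLinearEquiv.injective (hy.trans (map_zero e).symm) : ((0 : V), y) = 0)
  refine ⟨inj _ ?_, inj _ ?_⟩
  · rw [equiv_apply_α₁, h0, map_zero, Prod.mk_zero_zero]
  · rw [equiv_apply_α₂, h0, map_zero, Prod.mk_zero_zero]

/-- Joint surjectivity identifies `W` with `im (g₁ - 1) + im (g₂ - 1)`, which any isomorphism maps
into `W'`. -/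
theorem finrank_le_of_equiv [FiniteDimensional k W'] {X : KroneckerRep k V W}
    {Y : KroneckerRep k V' W'} (e : X.T.Equiv Y.T)
    (hX : LinearMap.range X.α₁ ⊔ LinearMap.range X.α₂ = ⊤) :
    Module.finrank k W ≤ Module.finrank k W' := by
  let f : W →ₗ[k] V' × W' := e.toLinearEquiv.toLinearMap ∘ₗ LinearMap.inr k V W
  have hf : LinearMap.fst k V' W' ∘ₗ f = 0 := linearMap_ext_of_range_sup hX
    (fun x => congrArg Prod.fst (equiv_apply_α₁ e x))
    (fun x => congrArg Prod.fst (equiv_apply_α₂ e x))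
  refine LinearMap.finrank_le_finrank_of_injective (f := LinearMap.snd k V' W' ∘ₗ f)
    fun x y hxy => LinearMap.inr_injective (e.toLinearEquiv.injective (Prod.ext ?_ hxy))
  exact (LinearMap.congr_fun hf x).trans (LinearMap.congr_fun hf y).symm

theorem isEmpty_leftRegular_equiv_T (X : KroneckerRep k V W) :
    IsEmpty ((Representation.leftRegular k KleinFour).Equiv X.T) := by
  refine ⟨fun e => KleinFour.loop_loop_single_ne_zero (k := k) (e.toLinearEquiv.injective ?_)⟩
  have he : ∀ g v, e (Representation.leftRegular k KleinFour g v) = X.T g (e v) :=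
    Representation.IntertwiningMap.isIntertwining _ _ e.toIntertwiningMap
  change e _ = e 0
  simp only [LinearMap.sub_apply, Module.End.one_apply, map_sub, he, map_zero]
  ext <;> simp

end

variable {k : Type u} [Field k] [CharP k 2]

/-- The point `λ` is recovered as the singular member of the pencil: `α₁ - μ α₂` for `(μ : 1)` and
`α₂` for `(1 : 0)`. It kills the first basis vector, while the same member is injective at any other
point. -/
theorem eq_of_R_equiv {q : ℕ} {l l' : Projectivization k (Fin 2 → k)}
    (e : (R (q + 1) l).T.Equiv (R (q + 1) l').T) : l = l' := by
  have hne : (Pi.single 0 1 : Fin (q + 1) → k) ≠ 0 := by simp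
  have hJ := toLin'_jordanBlock_zero_single_zero (k := k) q
  rcases l.eq_mk_affine_or_eq_mk_infinity with ⟨μ, h, rfl⟩ | ⟨h, rfl⟩ <;>
    rcases l'.eq_mk_affine_or_eq_mk_infinity with ⟨μ', h', rfl⟩ | ⟨h', rfl⟩
  · rw [R_affine, R_affine] at e
    by_cases hμ : μ' = μ
    · subst hμ
      rfl
    · refine absurd (apply_eq_zero_of_equiv e 1 (-μ) (fun x hx => ?_) (x := Pi.single 0 1) ?_).2 hne
      · refine eq_zero_of_toLin'_jordanBlock_eq_smul hμ ?_
        rwa [one_smul, neg_smul, ← sub_eq_add_neg, sub_eq_zero] at hx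
      · rw [toLin'_jordanBlock_eq, hJ]
        simp
  · rw [R_affine, R_infinity] at e
    exact absurd (apply_eq_zero_of_equiv e.symm 0 1 (fun x hx => by simpa using hx)
      (x := Pi.single 0 1) (by rw [hJ]; simp)).1 hne
  · rw [R_affine, R_infinity] at e
    exact absurd (apply_eq_zero_of_equiv e 0 1 (fun x hx => by simpa using hx)
      (x := Pi.single 0 1) (by rw [hJ]; simp)).1 hne
  · rfl

end KroneckerRep

/-! ### Assembling the list -/

section List

variable {k : Type u} [Field k] [CharP k 2]

theorem finiteDimensional_kleinRep (i : KleinIndex k) : FiniteDimensional k (kleinRep i).V := by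
  cases i with
  | regular => exact inferInstanceAs (FiniteDimensional k (MonoidAlgebra k KleinFour))
  | preprojective r _ =>
    exact inferInstanceAs (FiniteDimensional k ((Fin r → k) × (Fin (r + 1) → k)))
  | preinjective r =>
    exact inferInstanceAs (FiniteDimensional k ((Fin (r + 1) → k) × (Fin r → k)))
  | tube p _ _ => exact inferInstanceAs (FiniteDimensional k ((Fin p → k) × (Fin p → k)))

theorem isIndecomposable_kleinRep (i : KleinIndex k) : (kleinRep i).ρ.IsIndecomposable := by
  cases i with
  | regular => exact KleinFour.isIndecomposable_leftRegular
  | preprojective r hr =>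
    obtain ⟨m, rfl⟩ := Nat.exists_eq_add_of_le' hr
    exact KroneckerRep.isIndecomposable_T_P m
  | preinjective r => exact KroneckerRep.isIndecomposable_T_I r
  | tube p hp l =>
    obtain ⟨q, rfl⟩ := Nat.exists_eq_add_of_le' hp
    exact KroneckerRep.isIndecomposable_T_R q l

/-- The dimensions of the representations in the list. -/
def KleinIndex.dim : KleinIndex k → ℕ
  | .regular => 4
  | .preprojective r _ => 2 * r + 1
  | .preinjective r => 2 * r + 1
  | .tube p _ _ => 2 * p

theorem finrank_kleinRep (i : KleinIndex k) : Module.finrank k (kleinRep i).V = i.dim := by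
  cases i with
  | regular =>
    change Module.finrank k (MonoidAlgebra k KleinFour) = 4
    rw [(MonoidAlgebra.coeffLinearEquiv k).finrank_eq]
    simp
  | preprojective r hr =>
    change Module.finrank k ((Fin r → k) × (Fin (r + 1) → k)) = 2 * r + 1
    simp
    ring
  | preinjective r =>
    change Module.finrank k ((Fin (r + 1) → k) × (Fin r → k)) = 2 * r + 1
    simp
    ring
  | tube p hp l =>
    change Module.finrank k ((Fin p → k) × (Fin p → k)) = 2 * p
    simp
    ring

theorem preprojective_not_equiv_preinjective (r : ℕ) (hr : 1 ≤ r)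
    (e : (KroneckerRep.P k r).T.Equiv (KroneckerRep.I k r).T) : False := by
  obtain ⟨m, rfl⟩ := Nat.exists_eq_add_of_le' hr
  have := KroneckerRep.finrank_le_of_equiv e (KroneckerRep.range_sup_range_P m)
  simp at this

/-- Dimensions leave three kinds of coincidence: `k[G]` with tubes of `p = 2`, `P_r` with `I_r`, and
tubes of equal `p` at different points. -/
theorem eq_of_kleinRep_equiv {i j : KleinIndex k} (e : (kleinRep i).ρ.Equiv (kleinRep j).ρ) :
    i = j := by
  have hdim : i.dim = j.dim := by
    rw [← finrank_kleinRep, ← finrank_kleinRep]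
    exact e.toLinearEquiv.finrank_eq
  rcases i with _ | ⟨r, hr⟩ | r | ⟨p, hp, l⟩ <;> rcases j with _ | ⟨r', hr'⟩ | r' | ⟨p', hp', l'⟩ <;>
    simp only [KleinIndex.dim] at hdim <;> try omega
  · rfl
  · exact (KroneckerRep.isEmpty_leftRegular_equiv_T _).elim e
  · obtain rfl : r = r' := by omega
    rfl
  · obtain rfl : r = r' := by omega
    exact (preprojective_not_equiv_preinjective r hr e).elim
  · obtain rfl : r = r' := by omega
    exact (preprojective_not_equiv_preinjective r hr' e.symm).elim
  · obtain rfl : r = r' := by omega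
    rfl
  · exact (KroneckerRep.isEmpty_leftRegular_equiv_T _).elim e.symm
  · obtain rfl : p = p' := by omega
    obtain ⟨q, rfl⟩ := Nat.exists_eq_add_of_le' hp
    obtain rfl := KroneckerRep.eq_of_R_equiv e
    rfl

end List

theorem mainTheorem7 {k : Type u} [Field k] [IsAlgClosed k] [CharP k 2] :
    -- every representation in the list is finite dimensional and indecomposable
    (∀ i : KleinIndex k,
      FiniteDimensional k (kleinRep i).V ∧ (kleinRep i).ρ.IsIndecomposable) ∧
    -- every finite dimensional indecomposable representation is isomorphic to one in the list
    (∀ (V : Type v) [AddCommGroup V] [Module k V] [FiniteDimensional k V]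
      (ρ : Representation k KleinFour V), ρ.IsIndecomposable →
        ∃ i : KleinIndex k, Nonempty (ρ.Equiv (kleinRep i).ρ)) ∧
    -- the representations in the list are pairwise non-isomorphic
    (∀ i j : KleinIndex k, Nonempty ((kleinRep i).ρ.Equiv (kleinRep j).ρ) → i = j) :=
  ⟨fun i => ⟨finiteDimensional_kleinRep i, isIndecomposable_kleinRep i⟩,
    fun _ _ _ _ ρ hρ => KleinFour.exists_kleinIndex ρ hρ,
    fun _ _ ⟨e⟩ => eq_of_kleinRep_equiv e⟩
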